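/- For $n\ge 1$ let $S_n$ be the symmetric group on $[n]=\{1,\dots,n\}$. For $\sigma\in S_n$ let $H(\sigma,\mathrm{Id})=\sum_{i=1}^n|\sigma(i)-i|$ and let $C(\sigma)$ be the number of cycles of $\sigma$ (fixed points included). For $\beta_1,\beta_2\in\mathbb{R}$ let $\mathbb{P}_{\beta_1,\beta_2}$ be the probability measure on $S_n$ with $$\mathbb{P}_{\beta_1,\beta_2}(\sigma)\propto e^{-\beta_1 H(\sigma,\mathrm{Id})+\beta_2 C(\sigma)} .$$ For $\beta_1>0$, the twisted hit and run chain is the Markov chain on $S_n$ that moves from $\sigma$ to $\sigma'$ in two steps: (1) independently for each $i\in[n]$, sample $u_i$ uniformly from $[0,e^{-2\beta_1(\sigma(i)-i)_+}]$, where $x_+=\max\{x,0\}$, and let $b_i=i-\frac{\log u_i}{2\beta_1}$; (2) sample $\sigma'$ from the probability distribution on $S_n$ proportional to $\tau\mapsto e^{\beta_2 C(\tau)}\mathbf{1}\{\tau(i)\le b_i\text{ for every }i\in[n]\}$. Let $K^l_{\beta_1,\beta_2,\sigma_0}$ be the distribution of the chain after $l$ steps from the starting state $\sigma_0$, let $\|\mu-\nu\|=\frac12\sum_{\sigma\in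 S_n}|\mu(\sigma)-\nu(\sigma)|$ be the total variation distance, and let $t_{mix}(\epsilon)=\min\{l\ge 0:\max_{\sigma_0\in S_n}\|K^l_{\beta_1,\beta_2,\sigma_0}-\mathbb{P}_{\beta_1,\beta_2}\|\le\epsilon\}$. **Theorem.** There exist absolute constants $c_1^*,c_2^*>0$ and $N\in\mathbb{N}_+$ such that the following holds. Suppose that $0<\beta_1\le \frac{c_1^*}{n}$, $0\le\beta_2\le c_2^*$ and $n\ge N$. Then for any integer $l\ge 0$, $$\max_{\sigma_0\in S_n}\|K^l_{\beta_1,\beta_2,\sigma_0}-\mathbb{P}_{\beta_1,\beta_2}\|\le n^2\left(\tfrac12\right)^{l-1},$$ and $$t_{mix}\left(\tfrac14\right)\le 3+\left\lceil\frac{2\log n}{\log 2}\right\rceil .$$ -/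

import Mathlib

/-! The symmetric group `S_n` is `Equiv.Perm (Fin n)`. Labels run over `0, …, n - 1` instead of
`1, …, n`; every definition below depends only on differences and comparisons of labels, so this
shift changes nothing. -/

namespace TwistedHitAndRun

noncomputable section

/-- The `L¹` distance (Spearman's footrule) `H(σ, τ) = ∑ i, |σ(i) - τ(i)|` on permutations. -/
def l1Dist {n : ℕ} (σ τ : Equiv.Perm (Fin n)) : ℝ :=
  ∑ i, |((σ i : ℕ) : ℝ) - ((τ i : ℕ) : ℝ)|

/-- The number of cycles `C(σ)` of a permutation: the cycles of length at least two, which are the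
ones that `cycleType` lists, together with the fixed points. -/
def numCycles {n : ℕ} (σ : Equiv.Perm (Fin n)) : ℕ :=
  Multiset.card σ.cycleType + (Finset.univ.filter fun i => σ i = i).card

/-- The unnormalized weight `exp(-β₁ H(σ, Id) + β₂ C(σ))`. -/
def modelWeight (n : ℕ) (β₁ β₂ : ℝ) (σ : Equiv.Perm (Fin n)) : ℝ :=
  Real.exp (-β₁ * l1Dist σ 1 + β₂ * (numCycles σ : ℝ))

/-- The two-parameter permutation model: the probability mass function on `S_n` that is
proportional to `exp(-β₁ H(σ, Id) + β₂ C(σ))`. -/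
def model (n : ℕ) (β₁ β₂ : ℝ) (σ : Equiv.Perm (Fin n)) : ℝ :=
  modelWeight n β₁ β₂ σ / ∑ τ, modelWeight n β₁ β₂ τ

/-- The law of the auxiliary variables `u = (u_1, …, u_n)` given the current state `σ`: the `u_i`
are independent, and `u_i` is uniform on `[0, exp(-2 β₁ (σ(i) - i)₊)]`. -/
def auxLaw (n : ℕ) (β₁ : ℝ) (σ : Equiv.Perm (Fin n)) : MeasureTheory.Measure (Fin n → ℝ) :=
  MeasureTheory.Measure.pi fun i =>
    ProbabilityTheory.cond MeasureTheory.volume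
      (Set.Icc (0 : ℝ) (Real.exp (-2 * β₁ * max (((σ i : ℕ) : ℝ) - ((i : ℕ) : ℝ)) 0)))

/-- The thresholds `b_i = i - log(u_i) / (2 β₁)`. -/
def threshold (n : ℕ) (β₁ : ℝ) (u : Fin n → ℝ) (i : Fin n) : ℝ :=
  ((i : ℕ) : ℝ) - Real.log (u i) / (2 * β₁)

open Classical in
/-- The unnormalized weight `exp(β₂ C(τ)) 1{τ(i) ≤ b_i for every i}`. -/
def restrictedWeight (n : ℕ) (b : Fin n → ℝ) (β₂ : ℝ) (τ : Equiv.Perm (Fin n)) : ℝ :=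
  if ∀ i, ((τ i : ℕ) : ℝ) ≤ b i then Real.exp (β₂ * (numCycles τ : ℝ)) else 0

/-- The law `Q_{b, β₂}` on `S_n`, proportional to `exp(β₂ C(τ)) 1{τ(i) ≤ b_i for every i}`. -/
def restrictedLaw (n : ℕ) (b : Fin n → ℝ) (β₂ : ℝ) (τ : Equiv.Perm (Fin n)) : ℝ :=
  restrictedWeight n b β₂ τ / ∑ ρ, restrictedWeight n b β₂ ρ

/-- The transition matrix `K_{β₁, β₂}` of the twisted hit and run chain: from `σ`, draw the
auxiliary variables `u`, form the thresholds `b`, and move to a sample from `Q_{b, β₂}`. -/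
def transition (n : ℕ) (β₁ β₂ : ℝ) :
    Matrix (Equiv.Perm (Fin n)) (Equiv.Perm (Fin n)) ℝ :=
  Matrix.of fun σ σ' => ∫ u, restrictedLaw n (threshold n β₁ u) β₂ σ' ∂(auxLaw n β₁ σ)

/-- The total variation distance of two mass functions on a finite set. -/
def tvDist {Ω : Type*} [Fintype Ω] (μ ν : Ω → ℝ) : ℝ :=
  (1 / 2) * ∑ y, |μ y - ν y|

/-- `d(t) = max_x ‖K^t(x, ·) - π‖`, the distance to `π` after `t` steps of the chain with transition
matrix `K`, from the worst starting state. On a finite nonempty state space, the supremum is a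
maximum. -/
def worstDist {Ω : Type*} [Fintype Ω] [DecidableEq Ω] (K : Matrix Ω Ω ℝ) (π : Ω → ℝ) (t : ℕ) : ℝ :=
  ⨆ x, tvDist ((K ^ t) x) π

/-- The mixing time `t_mix(ε) = min {t : d(t) ≤ ε}`, which is `⊤` if there is no such `t`. -/
def mixingTime {Ω : Type*} [Fintype Ω] [DecidableEq Ω] (K : Matrix Ω Ω ℝ) (π : Ω → ℝ) (ε : ℝ) :
    ℕ∞ :=
  sInf {T : ℕ∞ | ∃ t : ℕ, (t : ℕ∞) = T ∧ worstDist K π t ≤ ε}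

end

end TwistedHitAndRun

/-! One step of the chain halves the Lipschitz constant of every function on `S_n`, for the metric
in which exchanging the values `a` and `b` costs `|a - b|`. This is path coupling in dual form. The
metric has diameter at most `n ^ 2` and distinct states are at distance at least one, so
stationarity of the model turns the contraction (`ExchangeLip.transition_mulVec`) into the total
variation bound.

The contraction rests on an exact description of `Q_{b, β₂}`: a sample is a product of
transpositions `swap i v` over the labels `v`, where the choices of `i ≤ v` are independent and `v ≤
b i` is the only constraint (`restrictedWeight_mul_swap`, `partialMean_succ`). Replacing the choice
laws one label at a time (`ExchangeLip.abs_partialMean_sub_le`) compares two threshold vectors: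
label `w` costs at most `w` times the `L¹` change of its choice law.

Drive two states that differ by an exchange of `a` and `b` with the same uniform variables. Only two
thresholds differ, and each pair is separated by `w` with probability at most `2 β₁ |a - b|`. Since
`β₁ ≤ 1 / (100 n)`, most thresholds exceed `n`, so the normalizer at `w` is of order `w` and cancels
the cost `w`. Summing over `w` gives a factor `48 β₁ n < 1 / 2`.

Stationarity (`sum_modelWeight_mul_transition`) is the usual auxiliary-variable argument. -/

namespace TwistedHitAndRun

open Equiv Finset

/-! ### Cycle counts under multiplication by a transposition. -/

section Cycles

variable {α : Type*} [Fintype α] [DecidableEq α]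

/-- Multiplying by a transposition that moves a fixed point `v` of `σ` merges `v` into another
cycle: the number of nontrivial cycles minus the size of the support drops by one. -/
lemma card_cycleType_swap_mul (σ : Perm α) {v y : α} (hv : σ v = v) (hy : y ≠ v) :
    Multiset.card (swap v y * σ).cycleType + σ.support.card + 1 =
      Multiset.card σ.cycleType + (swap v y * σ).support.card := by
  by_cases hfix : σ y = y
  · have hd : Perm.Disjoint (swap v y) σ := by
      intro x
      by_cases h1 : x = v
      · exact Or.inr (h1 ▸ hv)
      by_cases h2 : x = y
      · exact Or.inr (h2 ▸ hfix)
      exact Or.inl (swap_apply_of_ne_of_ne h1 h2)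
    rw [hd.cycleType_mul, hd.card_support_mul, (Perm.isCycle_swap hy.symm).cycleType,
      Perm.card_support_swap hy.symm]
    simp
    ring
  · have hys : y ∈ σ.support := Perm.mem_support.2 hfix
    set c := σ.cycleOf y with hc
    have hcm : c ∈ σ.cycleFactorsFinset := Perm.cycleOf_mem_cycleFactorsFinset_iff.2 hys
    have hcyc : c.IsCycle := Perm.isCycle_cycleOf σ hfix
    obtain ⟨t, ht⟩ : ∃ t, Perm.toList σ y = y :: t := by
      have h0 := Perm.toList_getElem_zero σ y hys
      have hpos := Perm.length_toList_pos_of_mem_support σ y hys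
      cases hl : Perm.toList σ y with
      | nil => simp [hl] at hpos
      | cons a t => simp [hl] at h0; exact ⟨t, by rw [h0]⟩
    have hform : List.formPerm (y :: t) = c := by rw [← ht, Perm.formPerm_toList]
    have hnd : (y :: t).Nodup := ht ▸ Perm.nodup_toList σ y
    have hmem : ∀ x, x ∈ y :: t ↔ x ∈ c.support := by
      intro x
      rw [← ht, Perm.mem_toList_iff, Perm.mem_support_cycleOf_iff]
    have hvt : v ∉ y :: t := by
      rw [hmem, Perm.mem_support_cycleOf_iff]
      rintro ⟨h, -⟩
      exact hfix (h.apply_eq_self_iff.2 hv)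
    have hnd' : (v :: y :: t).Nodup := List.nodup_cons.2 ⟨hvt, hnd⟩
    have hform' : swap v y * c = List.formPerm (v :: y :: t) := by
      rw [List.formPerm_cons_cons, hform]
    have hd := Perm.disjoint_mul_inv_of_mem_cycleFactorsFinset hcm
    set r := σ * c⁻¹ with hr
    have hσ : σ = c * r := by rw [hd.commute.eq.symm, hr]; simp
    have hlen : ∀ x : α, v :: y :: t ≠ [x] := by simp
    have hsupp : (swap v y * c).support = (v :: y :: t).toFinset := by
      rw [hform', List.support_formPerm_of_nodup _ hnd' hlen]
    have hcsupp : c.support = (y :: t).toFinset := by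
      ext x; rw [List.mem_toFinset, hmem]
    have hcyc' : (swap v y * c).IsCycle := by
      rw [hform']; exact List.isCycle_formPerm hnd' (by simp)
    have hcv : c v = v := by
      have := (hmem v).not.1 hvt
      simpa using this
    have hrv : r v = v := by
      have : c⁻¹ v = v := by rw [Perm.inv_eq_iff_eq, hcv]
      rw [hr, Perm.mul_apply, this, hv]
    have hd' : Perm.Disjoint (swap v y * c) r := by
      intro x
      by_cases hx : x ∈ (swap v y * c).support
      · right
        rw [hsupp, List.mem_toFinset, List.mem_cons] at hx
        rcases hx with rfl | hx
        · exact hrv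
        · exact (hd x).resolve_right (Perm.mem_support.1 ((hmem x).1 hx))
      · left; simpa using hx
    have hmul : swap v y * σ = (swap v y * c) * r := by rw [mul_assoc, ← hσ]
    have e1 : Multiset.card σ.cycleType = 1 + Multiset.card r.cycleType := by
      conv_lhs => rw [hσ]
      rw [hd.symm.cycleType_mul, hcyc.cycleType]; simp [add_comm]
    have e2 : σ.support.card = c.support.card + r.support.card := by
      conv_lhs => rw [hσ]
      rw [hd.symm.card_support_mul]
    have e3 : (swap v y * c).support.card = c.support.card + 1 := by
      rw [hsupp, hcsupp, List.toFinset_card_of_nodup hnd', List.toFinset_card_of_nodup hnd]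
      simp
    rw [hmul, hd'.cycleType_mul, hd'.card_support_mul, hcyc'.cycleType, e1, e2, e3]
    simp
    ring

end Cycles

variable {n : ℕ}

lemma numCycles_add_card_support (σ : Perm (Fin n)) :
    numCycles σ + σ.support.card = Multiset.card σ.cycleType + n := by
  have h := Finset.card_filter_add_card_filter_not (s := (univ : Finset (Fin n)))
    (p := fun i => σ i = i)
  have h2 : σ.support = univ.filter fun i => ¬ σ i = i := by ext; simp
  rw [numCycles, h2, add_assoc, h]
  simp

/-- Conjugation turns the right factor `swap i v` into the left factor `swap v (σ i)`, which absorbs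
the fixed point `v` into another cycle. -/
lemma numCycles_mul_swap (σ : Perm (Fin n)) {v i : Fin n} (hv : σ v = v) (hi : i ≠ v) :
    numCycles (σ * swap i v) + 1 = numCycles σ := by
  have e : σ * swap i v = swap v (σ i) * σ := by
    rw [mul_swap_eq_swap_mul, hv, swap_comm]
  have hy : σ i ≠ v := fun h => hi (σ.injective (h.trans hv.symm))
  have h := card_cycleType_swap_mul σ hv hy
  have h1 := numCycles_add_card_support σ
  have h2 := numCycles_add_card_support (swap v (σ i) * σ)
  rw [e]; omega

/-! ### The restricted law as a product of independent choices. -/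

/-- The permutations that fix every label `≥ v`. -/
def tailStab (n v : ℕ) : Finset (Perm (Fin n)) :=
  univ.filter fun τ => ∀ p : Fin n, v ≤ (p : ℕ) → τ p = p

lemma mem_tailStab {v : ℕ} {τ : Perm (Fin n)} :
    τ ∈ tailStab n v ↔ ∀ p : Fin n, v ≤ (p : ℕ) → τ p = p := by simp [tailStab]

lemma tailStab_zero : tailStab n 0 = {1} := by
  ext τ
  simp [mem_tailStab, Equiv.ext_iff]

lemma tailStab_self : tailStab n n = univ := by
  ext τ
  simp only [mem_tailStab, mem_univ, iff_true]
  intro p hp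
  exact absurd p.2 (by omega)

lemma apply_le_of_mem_tailStab {v : Fin n} {τ : Perm (Fin n)} (hτ : τ ∈ tailStab n v) {i : Fin n}
    (hi : i ≤ v) : τ i ≤ v := by
  by_contra h
  have h1 := mem_tailStab.1 hτ (τ i) (le_of_lt (not_le.1 h))
  have h2 := τ.injective h1
  exact h (h2.symm ▸ hi)

lemma mul_swap_mem_tailStab {v : Fin n} {τ : Perm (Fin n)} (hτ : τ ∈ tailStab n v) {i : Fin n}
    (hi : i ≤ v) : τ * swap i v ∈ tailStab n (v + 1) := by
  rw [mem_tailStab]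
  intro p hp
  have hvp : v < p := hp
  rw [Perm.mul_apply, swap_apply_of_ne_of_ne (hi.trans_lt hvp).ne' hvp.ne']
  exact mem_tailStab.1 hτ p (le_of_lt hvp)

lemma inv_apply_le_of_mem_tailStab {v : Fin n} {τ : Perm (Fin n)} (hτ : τ ∈ tailStab n (v + 1)) :
    τ⁻¹ v ≤ v := by
  by_contra hlt
  have h := mem_tailStab.1 hτ (τ⁻¹ v) (not_le.1 hlt)
  have h' : τ (τ⁻¹ v) = v := τ.apply_symm_apply v
  exact hlt (h.symm.trans h').le

lemma mul_swap_inv_mem_tailStab {v : Fin n} {τ : Perm (Fin n)} (hτ : τ ∈ tailStab n (v + 1)) :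
    τ * swap (τ⁻¹ v) v ∈ tailStab n v := by
  refine mem_tailStab.2 fun p hp => ?_
  rcases eq_or_lt_of_le (show v ≤ p from hp) with rfl | hlt
  · rw [Perm.mul_apply, swap_apply_right]
    exact τ.apply_symm_apply v
  · rw [Perm.mul_apply,
      swap_apply_of_ne_of_ne ((inv_apply_le_of_mem_tailStab hτ).trans_lt hlt).ne' hlt.ne']
    exact mem_tailStab.1 hτ p hlt

/-- Coset decomposition: the preimage `i` of `v` determines the representative `swap i v`. -/
lemma sum_tailStab_succ (v : Fin n) (F : Perm (Fin n) → ℝ) :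
    ∑ τ ∈ tailStab n (v + 1), F τ = ∑ τ ∈ tailStab n v, ∑ i ∈ Iic v, F (τ * swap i v) := by
  rw [← Finset.sum_product']
  symm
  refine Finset.sum_bij' (fun x _ => x.1 * swap x.2 v) (fun τ _ => (τ * swap (τ⁻¹ v) v, τ⁻¹ v))
    ?_ ?_ ?_ ?_ ?_
  · rintro ⟨τ, i⟩ h
    rw [mem_product, mem_Iic] at h
    exact mul_swap_mem_tailStab h.1 h.2
  · intro τ h
    rw [mem_product, mem_Iic]
    exact ⟨mul_swap_inv_mem_tailStab h, inv_apply_le_of_mem_tailStab h⟩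
  · rintro ⟨τ, i⟩ h
    rw [mem_product] at h
    have hv : τ v = v := mem_tailStab.1 h.1 v le_rfl
    have : (τ * swap i v)⁻¹ v = i := by
      rw [Perm.inv_eq_iff_eq]; simp [hv]
    simp only [this, mul_assoc, swap_mul_self, mul_one]
  · intro τ h
    simp [mul_assoc]
  · intros; rfl

/-- The weight of choosing `i` as the preimage of `v` when the labels above `v` have been placed. -/
noncomputable def stepWeight (b : Fin n → ℝ) (β₂ : ℝ) (v i : Fin n) : ℝ :=
  open Classical in
  if i ≤ v ∧ ((v : ℕ) : ℝ) ≤ b i then (if i = v then Real.exp β₂ else 1) else 0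

/-- The probability of choosing `i` as the preimage of `v`. -/
noncomputable def stepProb (b : Fin n → ℝ) (β₂ : ℝ) (v i : Fin n) : ℝ :=
  stepWeight b β₂ v i / ∑ j, stepWeight b β₂ v j

/-- Averaging a function over the choice of the preimage of `v`. -/
noncomputable def stepMean (b : Fin n → ℝ) (β₂ : ℝ) (v : Fin n) (f : Perm (Fin n) → ℝ)
    (τ : Perm (Fin n)) : ℝ :=
  ∑ i, stepProb b β₂ v i * f (τ * swap i v)

/-- The mean of `f` under the restricted law conditioned to fix every label `≥ v`. -/
noncomputable def partialMean (b : Fin n → ℝ) (β₂ : ℝ) (v : ℕ) (f : Perm (Fin n) → ℝ) : ℝ :=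
  (∑ τ ∈ tailStab n v, restrictedWeight n b β₂ τ * f τ) /
    ∑ τ ∈ tailStab n v, restrictedWeight n b β₂ τ

lemma stepWeight_nonneg (b : Fin n → ℝ) (β₂ : ℝ) (v i : Fin n) : 0 ≤ stepWeight b β₂ v i := by
  unfold stepWeight
  split_ifs <;> positivity

lemma restrictedWeight_nonneg (b : Fin n → ℝ) (β₂ : ℝ) (τ : Perm (Fin n)) :
    0 ≤ restrictedWeight n b β₂ τ := by
  unfold restrictedWeight
  split_ifs <;> positivity

section

variable {b b' : Fin n → ℝ} {β₂ : ℝ}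

lemma restrictedWeight_one_pos (hb : ∀ i : Fin n, ((i : ℕ) : ℝ) ≤ b i) :
    0 < restrictedWeight n b β₂ 1 := by
  unfold restrictedWeight
  rw [if_pos (by simpa using hb)]
  positivity

lemma sum_stepWeight_pos (hb : ∀ i : Fin n, ((i : ℕ) : ℝ) ≤ b i) (v : Fin n) :
    0 < ∑ j, stepWeight b β₂ v j := by
  refine Finset.sum_pos' (fun i _ => stepWeight_nonneg b β₂ v i) ⟨v, mem_univ v, ?_⟩
  simp only [stepWeight, le_refl, hb v, and_self, if_true]
  positivity

lemma sum_stepProb (hb : ∀ i : Fin n, ((i : ℕ) : ℝ) ≤ b i) (v : Fin n) :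
    ∑ j, stepProb b β₂ v j = 1 := by
  unfold stepProb
  rw [← Finset.sum_div, div_self (sum_stepWeight_pos hb v).ne']

lemma stepProb_nonneg (v i : Fin n) : 0 ≤ stepProb b β₂ v i :=
  div_nonneg (stepWeight_nonneg _ _ _ _) (Finset.sum_nonneg fun _ _ => stepWeight_nonneg _ _ _ _)

lemma stepProb_of_lt {v i : Fin n} (h : v < i) : stepProb b β₂ v i = 0 := by
  simp [stepProb, stepWeight, not_le.2 h]

lemma sum_restrictedWeight_pos (hb : ∀ i : Fin n, ((i : ℕ) : ℝ) ≤ b i) (v : ℕ) :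
    0 < ∑ τ ∈ tailStab n v, restrictedWeight n b β₂ τ :=
  Finset.sum_pos' (fun τ _ => restrictedWeight_nonneg b β₂ τ)
    ⟨1, mem_tailStab.2 (by simp), restrictedWeight_one_pos hb⟩

/-- The new permutation sends `i` to `v` and `v` to `τ i`. As `τ i ≤ v ≤ b v`, position `v` imposes
nothing, and `v ≤ b i` implies the old constraint at `i`. A cycle is lost unless `i = v`. The factor
depends on `τ` only through its old weight, which is what makes the choices independent. -/
lemma restrictedWeight_mul_swap (hb : ∀ i : Fin n, ((i : ℕ) : ℝ) ≤ b i) {v : Fin n}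
    {τ : Perm (Fin n)} (hτ : τ ∈ tailStab n v) {i : Fin n} (hi : i ≤ v) :
    restrictedWeight n b β₂ (τ * swap i v) * Real.exp β₂ =
      stepWeight b β₂ v i * restrictedWeight n b β₂ τ := by
  have hv : τ v = v := mem_tailStab.1 hτ v le_rfl
  have key : (∀ p, (((τ * swap i v) p : ℕ) : ℝ) ≤ b p) ↔
      ((v : ℕ) : ℝ) ≤ b i ∧ ∀ p, ((τ p : ℕ) : ℝ) ≤ b p := by
    have hτi : ((τ i : ℕ) : ℝ) ≤ ((v : ℕ) : ℝ) := by
      exact_mod_cast apply_le_of_mem_tailStab hτ hi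
    constructor
    · intro h
      have h1 : ((v : ℕ) : ℝ) ≤ b i := by simpa [hv] using h i
      refine ⟨h1, fun p => ?_⟩
      by_cases hp : p = v
      · subst hp; rw [hv]; exact hb p
      by_cases hp' : p = i
      · subst hp'; exact hτi.trans h1
      · simpa [swap_apply_of_ne_of_ne hp' hp] using h p
    · rintro ⟨h1, h⟩ p
      by_cases hp' : p = i
      · subst hp'; simpa [hv] using h1
      by_cases hp : p = v
      · subst hp; simpa using hτi.trans (hb p)
      · simpa [swap_apply_of_ne_of_ne hp' hp] using h p
  unfold restrictedWeight stepWeight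
  by_cases hiv : i = v
  · subst hiv
    rw [if_pos (⟨hi, hb i⟩ : i ≤ i ∧ _), if_pos rfl, swap_self, ← Perm.one_def, mul_one]
    ring
  · have hc := numCycles_mul_swap τ hv hiv
    have hc' : (numCycles τ : ℝ) = numCycles (τ * swap i v) + 1 := by exact_mod_cast hc.symm
    by_cases h1 : ((v : ℕ) : ℝ) ≤ b i <;> by_cases h2 : ∀ p, ((τ p : ℕ) : ℝ) ≤ b p
    · rw [if_pos (key.2 ⟨h1, h2⟩), if_pos ⟨hi, h1⟩, if_neg hiv, if_pos h2, hc', ← Real.exp_add]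
      ring_nf
    · rw [if_neg (fun h => h2 (key.1 h).2), if_neg h2]; ring
    · rw [if_neg (fun h => h1 (key.1 h).1), if_neg (fun h => h1 h.2)]; ring
    · rw [if_neg (fun h => h1 (key.1 h).1), if_neg (fun h => h1 h.2)]; ring

lemma sum_tailStab_succ_restrictedWeight (hb : ∀ i : Fin n, ((i : ℕ) : ℝ) ≤ b i) (v : Fin n)
    (f : Perm (Fin n) → ℝ) :
    (∑ τ ∈ tailStab n (v + 1), restrictedWeight n b β₂ τ * f τ) * Real.exp β₂ =
      (∑ j, stepWeight b β₂ v j) *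
        ∑ τ ∈ tailStab n v, restrictedWeight n b β₂ τ * stepMean b β₂ v f τ := by
  rw [sum_tailStab_succ, Finset.sum_mul, Finset.mul_sum]
  refine Finset.sum_congr rfl fun τ hτ => ?_
  have hW := (sum_stepWeight_pos (β₂ := β₂) hb v).ne'
  have h1 : (∑ j, stepWeight b β₂ v j) * (restrictedWeight n b β₂ τ * stepMean b β₂ v f τ) =
      ∑ i, stepWeight b β₂ v i * restrictedWeight n b β₂ τ * f (τ * swap i v) := by
    unfold stepMean stepProb
    rw [mul_left_comm, Finset.mul_sum, Finset.mul_sum]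
    refine Finset.sum_congr rfl fun i _ => ?_
    field_simp
  rw [h1, Finset.sum_mul]
  have h2 : ∑ i, stepWeight b β₂ v i * restrictedWeight n b β₂ τ * f (τ * swap i v) =
      ∑ i ∈ Iic v, stepWeight b β₂ v i * restrictedWeight n b β₂ τ * f (τ * swap i v) := by
    symm
    refine Finset.sum_subset (subset_univ _) fun i _ hi => ?_
    rw [mem_Iic] at hi
    simp [stepWeight, hi]
  rw [h2]
  refine Finset.sum_congr rfl fun i hi => ?_
  rw [mul_right_comm, restrictedWeight_mul_swap hb hτ (mem_Iic.1 hi)]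

lemma stepMean_one (hb : ∀ i : Fin n, ((i : ℕ) : ℝ) ≤ b i) (v : Fin n) (τ : Perm (Fin n)) :
    stepMean b β₂ v (fun _ => 1) τ = 1 := by
  simp [stepMean, sum_stepProb hb v]

/-- The normalizer of the choice at `v` does not depend on `τ`, so it cancels between numerator and
denominator. -/
lemma partialMean_succ (hb : ∀ i : Fin n, ((i : ℕ) : ℝ) ≤ b i) (v : Fin n)
    (f : Perm (Fin n) → ℝ) :
    partialMean b β₂ (v + 1) f = partialMean b β₂ v (stepMean b β₂ v f) := by
  have h1 := sum_tailStab_succ_restrictedWeight (β₂ := β₂) hb v f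
  have h2 := sum_tailStab_succ_restrictedWeight (β₂ := β₂) hb v (fun _ => 1)
  simp only [stepMean_one hb v, mul_one] at h2
  have hW := sum_stepWeight_pos (β₂ := β₂) hb v
  have hZ := sum_restrictedWeight_pos (β₂ := β₂) hb v
  have hZ' := sum_restrictedWeight_pos (β₂ := β₂) hb (v + 1)
  have he := Real.exp_pos β₂
  unfold partialMean
  rw [← mul_div_mul_right _ _ he.ne', h1, h2, mul_div_mul_left _ _ hW.ne']

lemma partialMean_zero (hb : ∀ i : Fin n, ((i : ℕ) : ℝ) ≤ b i) (f : Perm (Fin n) → ℝ) :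
    partialMean b β₂ 0 f = f 1 := by
  have := (restrictedWeight_one_pos (β₂ := β₂) hb).ne'
  simp [partialMean, tailStab_zero, this]

lemma partialMean_self (f : Perm (Fin n) → ℝ) :
    partialMean b β₂ n f = ∑ τ, restrictedLaw n b β₂ τ * f τ := by
  simp only [partialMean, tailStab_self, restrictedLaw, Finset.sum_div]
  exact Finset.sum_congr rfl fun τ _ => by ring

lemma partialMean_sub (v : ℕ) (f g : Perm (Fin n) → ℝ) :
    partialMean b β₂ v f - partialMean b β₂ v g = partialMean b β₂ v (fun τ => f τ - g τ) := by
  simp only [partialMean, mul_sub, Finset.sum_sub_distrib, sub_div]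

lemma abs_partialMean_le (hb : ∀ i : Fin n, ((i : ℕ) : ℝ) ≤ b i) (v : ℕ) {f : Perm (Fin n) → ℝ}
    {M : ℝ} (hf : ∀ τ ∈ tailStab n v, |f τ| ≤ M) : |partialMean b β₂ v f| ≤ M := by
  have hZ := sum_restrictedWeight_pos (β₂ := β₂) hb v
  rw [partialMean, abs_div, abs_of_pos hZ, div_le_iff₀ hZ, Finset.mul_sum]
  refine (Finset.abs_sum_le_sum_abs _ _).trans (Finset.sum_le_sum fun τ hτ => ?_)
  rw [abs_mul, abs_of_nonneg (restrictedWeight_nonneg b β₂ τ), mul_comm]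
  exact mul_le_mul_of_nonneg_right (hf τ hτ) (restrictedWeight_nonneg b β₂ τ)

end

/-! ### Lipschitz functions and comparison of two threshold vectors. -/

/-- `f` is `D`-Lipschitz for the metric in which exchanging the values `a` and `b` of a
permutation costs `|a - b|`. -/
def ExchangeLip (D : ℝ) (f : Perm (Fin n) → ℝ) : Prop :=
  ∀ (a b : Fin n) (σ : Perm (Fin n)),
    |f (swap a b * σ) - f σ| ≤ D * |((a : ℕ) : ℝ) - ((b : ℕ) : ℝ)|

section Lip

variable {b b' : Fin n → ℝ} {β₂ D : ℝ} {f : Perm (Fin n) → ℝ}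

/-- Exchanging values multiplies on the left and a choice multiplies on the right; the two commute,
so averaging preserves the constant. -/
lemma ExchangeLip.stepMean (hf : ExchangeLip D f) (hb : ∀ i : Fin n, ((i : ℕ) : ℝ) ≤ b i)
    (v : Fin n) : ExchangeLip D (stepMean b β₂ v f) := by
  intro x y σ
  unfold TwistedHitAndRun.stepMean
  rw [← Finset.sum_sub_distrib]
  calc |∑ i, (stepProb b β₂ v i * f (swap x y * σ * swap i v) -
          stepProb b β₂ v i * f (σ * swap i v))|
      ≤ ∑ i, stepProb b β₂ v i * (D * |((x : ℕ) : ℝ) - ((y : ℕ) : ℝ)|) := by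
        refine (Finset.abs_sum_le_sum_abs _ _).trans (Finset.sum_le_sum fun i _ => ?_)
        rw [← mul_sub, abs_mul, abs_of_nonneg (stepProb_nonneg v i), mul_assoc]
        exact mul_le_mul_of_nonneg_left (hf x y _) (stepProb_nonneg v i)
    _ = D * |((x : ℕ) : ℝ) - ((y : ℕ) : ℝ)| := by
        rw [← Finset.sum_mul, sum_stepProb hb v, one_mul]

lemma ExchangeLip.abs_mul_swap_sub_le (hf : ExchangeLip D f) (hD : 0 ≤ D) {v : Fin n}
    {τ : Perm (Fin n)} (hτ : τ ∈ tailStab n v) {i : Fin n} (hi : i ≤ v) :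
    |f (τ * swap i v) - f τ| ≤ D * ((v : ℕ) : ℝ) := by
  have hv : τ v = v := mem_tailStab.1 hτ v le_rfl
  rw [mul_swap_eq_swap_mul, hv]
  refine (hf _ _ _).trans (mul_le_mul_of_nonneg_left ?_ hD)
  have h1 : ((τ i : ℕ) : ℝ) ≤ ((v : ℕ) : ℝ) := by exact_mod_cast apply_le_of_mem_tailStab hτ hi
  have h2 : (0 : ℝ) ≤ ((τ i : ℕ) : ℝ) := by positivity
  rw [abs_le]; constructor <;> linarith

/-- A hybrid argument: replace the choice law at the top label, then apply induction to the averaged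
function, which is still `D`-Lipschitz. -/
lemma ExchangeLip.abs_partialMean_sub_le (hD : 0 ≤ D) (hb : ∀ i : Fin n, ((i : ℕ) : ℝ) ≤ b i)
    (hb' : ∀ i : Fin n, ((i : ℕ) : ℝ) ≤ b' i) (v : ℕ) (hv : v ≤ n) :
    ∀ f : Perm (Fin n) → ℝ, ExchangeLip D f →
    |partialMean b β₂ v f - partialMean b' β₂ v f| ≤
      ∑ w ∈ univ.filter (fun w : Fin n => (w : ℕ) < v),
        D * ((w : ℕ) : ℝ) * ∑ i, |stepProb b β₂ w i - stepProb b' β₂ w i| := by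
  induction v with
  | zero => intro f _; simp [partialMean_zero hb, partialMean_zero hb']
  | succ v ih =>
    intro f hf
    obtain ⟨w, rfl⟩ : ∃ w : Fin n, (w : ℕ) = v := ⟨⟨v, hv⟩, rfl⟩
    have hfil : univ.filter (fun x : Fin n => (x : ℕ) < (w : ℕ) + 1) =
        insert w (univ.filter (fun x : Fin n => (x : ℕ) < (w : ℕ))) := by
      ext x
      simp only [mem_filter, mem_univ, true_and, mem_insert, Fin.ext_iff]
      omega
    rw [hfil, Finset.sum_insert (by simp), partialMean_succ hb, partialMean_succ hb']
    have h1 := ih (by omega) _ (hf.stepMean (β₂ := β₂) hb' w)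
    have h2 : |partialMean b β₂ w (TwistedHitAndRun.stepMean b β₂ w f) -
        partialMean b β₂ w (TwistedHitAndRun.stepMean b' β₂ w f)| ≤
        D * ((w : ℕ) : ℝ) * ∑ i, |stepProb b β₂ w i - stepProb b' β₂ w i| := by
      rw [partialMean_sub]
      refine abs_partialMean_le hb _ fun τ hτ => ?_
      -- Both choice laws have total mass one, so `f τ` may be subtracted for free; the increments
      -- left are at most `D * w`.
      have e : TwistedHitAndRun.stepMean b β₂ w f τ - TwistedHitAndRun.stepMean b' β₂ w f τ =
          ∑ i, (stepProb b β₂ w i - stepProb b' β₂ w i) * (f (τ * swap i w) - f τ) := by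
        simp only [sub_mul, mul_sub, Finset.sum_sub_distrib, ← Finset.sum_mul, sum_stepProb hb,
          sum_stepProb hb', TwistedHitAndRun.stepMean]
        ring
      rw [e, Finset.mul_sum]
      refine (Finset.abs_sum_le_sum_abs _ _).trans (Finset.sum_le_sum fun i _ => ?_)
      rw [abs_mul, mul_comm]
      by_cases hi : i ≤ w
      · exact mul_le_mul_of_nonneg_right (hf.abs_mul_swap_sub_le hD hτ hi) (abs_nonneg _)
      · simp [stepProb_of_lt (not_le.1 hi)]
    calc _ ≤ _ := abs_sub_le _ (partialMean b β₂ w (TwistedHitAndRun.stepMean b' β₂ w f)) _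
      _ ≤ _ := add_le_add h2 h1

lemma sum_abs_div_sub_div_le {ι : Type*} [Fintype ι] (w w' : ι → ℝ) (hw' : ∀ i, 0 ≤ w' i)
    (hW : 0 < ∑ i, w i) (hW' : 0 < ∑ i, w' i) :
    ∑ i, |w i / (∑ j, w j) - w' i / (∑ j, w' j)| ≤ 2 * (∑ i, |w i - w' i|) / ∑ j, w j := by
  set W := ∑ i, w i
  set W' := ∑ i, w' i
  have h1 : ∀ i, |w i / W - w' i / W'| ≤ |w i - w' i| / W + w' i * (|W' - W| / (W * W')) := by
    intro i
    have : w i / W - w' i / W' = (w i - w' i) / W + w' i * ((W' - W) / (W * W')) := by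
      field_simp; ring
    rw [this]
    refine (abs_add_le _ _).trans (le_of_eq ?_)
    rw [abs_div, abs_of_pos hW, abs_mul, abs_of_nonneg (hw' i), abs_div, abs_of_pos (mul_pos hW hW')]
  have h2 : |W' - W| ≤ ∑ i, |w i - w' i| := by
    rw [abs_sub_comm, ← Finset.sum_sub_distrib]
    exact Finset.abs_sum_le_sum_abs _ _
  calc ∑ i, |w i / W - w' i / W'|
      ≤ ∑ i, (|w i - w' i| / W + w' i * (|W' - W| / (W * W'))) := Finset.sum_le_sum fun i _ => h1 i
    _ = (∑ i, |w i - w' i|) / W + |W' - W| / W := by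
        rw [Finset.sum_add_distrib, ← Finset.sum_div, ← Finset.sum_mul]
        congr 1
        field_simp
        rfl
    _ ≤ 2 * (∑ i, |w i - w' i|) / W := by
        rw [← add_div]
        gcongr
        linarith

/-- The indicator of `x < v ≤ y` or `y < v ≤ x`. -/
noncomputable def separates (v x y : ℝ) : ℝ :=
  open Classical in if (v ≤ x ↔ v ≤ y) then 0 else 1

/-- The choice `i = v` is allowed for both vectors, so only choices of weight one can switch and no
factor `exp β₂` enters the numerator. In the normalizer, `β₂ ≥ 0` makes every allowed choice weigh
at least one. -/
lemma sum_abs_stepProb_sub_le (hβ : 0 ≤ β₂) (hb : ∀ i : Fin n, ((i : ℕ) : ℝ) ≤ b i)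
    (hb' : ∀ i : Fin n, ((i : ℕ) : ℝ) ≤ b' i) (v : Fin n) (S : Finset (Fin n))
    (hS : ∀ i ∈ S, i < v) :
    ∑ i, |stepProb b β₂ v i - stepProb b' β₂ v i| ≤
      2 * (∑ i, separates (v : ℕ) (b i) (b' i)) /
        (1 + (S.filter fun i => ((v : ℕ) : ℝ) ≤ b i).card) := by
  classical
  refine (sum_abs_div_sub_div_le _ _ (fun i => stepWeight_nonneg b' β₂ v i)
    (sum_stepWeight_pos hb v) (sum_stepWeight_pos hb' v)).trans ?_
  have h1 : ∀ i, |stepWeight b β₂ v i - stepWeight b' β₂ v i| ≤ separates (v : ℕ) (b i) (b' i) := by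
    intro i
    by_cases hiv : i = v
    · subst hiv
      simp [stepWeight, separates, hb i, hb' i]
    · unfold stepWeight separates
      by_cases hle : i ≤ v <;> by_cases ha : ((v : ℕ) : ℝ) ≤ b i <;>
        by_cases ha' : ((v : ℕ) : ℝ) ≤ b' i <;> simp [hiv, hle, ha, ha']
  have h2 : (1 : ℝ) + (S.filter fun i => ((v : ℕ) : ℝ) ≤ b i).card ≤ ∑ j, stepWeight b β₂ v j := by
    have hv : v ∉ S.filter fun i => ((v : ℕ) : ℝ) ≤ b i := fun h =>
      lt_irrefl v (hS v (Finset.mem_of_mem_filter v h))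
    calc (1 : ℝ) + (S.filter fun i => ((v : ℕ) : ℝ) ≤ b i).card
        = ∑ j ∈ insert v (S.filter fun i => ((v : ℕ) : ℝ) ≤ b i), (1 : ℝ) := by
          rw [Finset.sum_const, Finset.card_insert_of_notMem hv]; simp [add_comm]
      _ ≤ ∑ j ∈ insert v (S.filter fun i => ((v : ℕ) : ℝ) ≤ b i), stepWeight b β₂ v j := by
          refine Finset.sum_le_sum fun j hj => ?_
          rcases Finset.mem_insert.1 hj with rfl | hj
          · simp [stepWeight, hb j, hβ]
          · have hj' := Finset.mem_filter.1 hj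
            have hlt := hS j hj'.1
            simp [stepWeight, hlt.le, hj'.2, hlt.ne]
      _ ≤ _ := Finset.sum_le_univ_sum_of_nonneg fun j => stepWeight_nonneg b β₂ v j
  have h3 : ∑ i, |stepWeight b β₂ v i - stepWeight b' β₂ v i| ≤
      ∑ i, separates (v : ℕ) (b i) (b' i) := Finset.sum_le_sum fun i _ => h1 i
  have h4 : (0 : ℝ) ≤ ∑ i, |stepWeight b β₂ v i - stepWeight b' β₂ v i| :=
    Finset.sum_nonneg fun _ _ => abs_nonneg _
  exact div_le_div₀ (by linarith) (by linarith) (by positivity) h2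

/-- Removing the transpositions from the top label down costs at most `D * w` at each label `w < v`.
-/
lemma ExchangeLip.abs_sub_one_le (hf : ExchangeLip D f) (hD : 0 ≤ D) (v : ℕ) (hv : v ≤ n) :
    ∀ τ ∈ tailStab n v, |f τ - f 1| ≤ D * ((v : ℝ) ^ 2 / 2) := by
  induction v with
  | zero => intro τ hτ; simp [tailStab_zero] at hτ; simp [hτ]
  | succ v ih =>
    intro τ hτ
    obtain ⟨w, rfl⟩ : ∃ w : Fin n, (w : ℕ) = v := ⟨⟨v, hv⟩, rfl⟩
    have hle := inv_apply_le_of_mem_tailStab hτ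
    have hmem := mul_swap_inv_mem_tailStab hτ
    have h1 := ih (by omega) _ hmem
    have h2 := hf.abs_mul_swap_sub_le hD hmem hle
    rw [mul_assoc, swap_mul_self, mul_one] at h2
    calc _ ≤ _ := abs_sub_le _ (f (τ * swap (τ⁻¹ w) w)) _
      _ ≤ _ := add_le_add h2 h1
      _ ≤ _ := by push_cast; nlinarith

lemma ExchangeLip.abs_sub_le (hf : ExchangeLip D f) (hD : 0 ≤ D) (σ τ : Perm (Fin n)) :
    |f σ - f τ| ≤ D * (n : ℝ) ^ 2 := by
  have h1 := hf.abs_sub_one_le hD n le_rfl σ (by simp [tailStab_self])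
  have h2 := hf.abs_sub_one_le hD n le_rfl τ (by simp [tailStab_self])
  rw [abs_sub_comm] at h2
  calc _ ≤ _ := _root_.abs_sub_le _ (f 1) _
    _ ≤ _ := add_le_add h1 h2
    _ = _ := by ring

end Lip

end TwistedHitAndRun

/-! ### Common uniform variables and the integral estimates. -/

namespace TwistedHitAndRun

open Equiv Finset MeasureTheory

/-- The uniform law on `[0, 1]`. -/
noncomputable def unitLaw : Measure ℝ := volume.restrict (Set.Icc 0 1)

instance : IsProbabilityMeasure unitLaw := ⟨by simp [unitLaw]⟩

lemma unitLaw_ae : ∀ᵐ t ∂unitLaw, 0 < t ∧ t ≤ 1 := by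
  have h : ∀ᵐ t ∂unitLaw, t ≠ 0 := ae_restrict_of_ae (Measure.ae_ne volume 0)
  filter_upwards [h, ae_restrict_mem measurableSet_Icc] with t h0 ht
  exact ⟨lt_of_le_of_ne ht.1 h0.symm, ht.2⟩

lemma cond_volume_Icc_eq_map {A : ℝ} (hA : 0 < A) :
    ProbabilityTheory.cond volume (Set.Icc 0 A) = unitLaw.map (A * ·) := by
  ext t ht
  have hm : Measurable (A * · : ℝ → ℝ) := measurable_const_mul A
  have hpre : (A * · : ℝ → ℝ) ⁻¹' t ∩ Set.Icc 0 1 = (A * ·) ⁻¹' (Set.Icc 0 A ∩ t) := by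
    ext x
    simp only [Set.mem_inter_iff, Set.mem_preimage, Set.mem_Icc]
    constructor
    · rintro ⟨h1, h2, h3⟩
      exact ⟨⟨by positivity, by nlinarith⟩, h1⟩
    · rintro ⟨⟨h2, h3⟩, h1⟩
      exact ⟨h1, nonneg_of_mul_nonneg_right h2 hA, by nlinarith⟩
  rw [ProbabilityTheory.cond_apply measurableSet_Icc, Measure.map_apply hm ht, unitLaw,
    Measure.restrict_apply (hm ht), hpre, Real.volume_preimage_mul_left hA.ne', Real.volume_Icc,
    sub_zero, abs_of_pos (inv_pos.2 hA), ENNReal.ofReal_inv_of_pos hA]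

variable {n : ℕ}

/-- The length of the interval from which the `i`-th auxiliary variable is drawn. -/
noncomputable def auxLength (β₁ : ℝ) (σ : Perm (Fin n)) (i : Fin n) : ℝ :=
  Real.exp (-2 * β₁ * max (((σ i : ℕ) : ℝ) - ((i : ℕ) : ℝ)) 0)

lemma auxLength_pos (β₁ : ℝ) (σ : Perm (Fin n)) (i : Fin n) : 0 < auxLength β₁ σ i :=
  Real.exp_pos _

lemma measurable_scale (A : Fin n → ℝ) : Measurable fun (u : Fin n → ℝ) i => A i * u i := by
  fun_prop

/-- This is the coupling: the same uniform variables serve every starting state. -/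
lemma auxLaw_eq_map (β₁ : ℝ) (σ : Perm (Fin n)) :
    auxLaw n β₁ σ =
      (Measure.pi fun _ => unitLaw).map fun u i => auxLength β₁ σ i * u i := by
  have h := Measure.pi_map_pi (μ := fun _ : Fin n => unitLaw)
    (f := fun i t => auxLength β₁ σ i * t) (fun i => by fun_prop)
  rw [h, auxLaw]
  congr 1
  funext i
  exact cond_volume_Icc_eq_map (auxLength_pos β₁ σ i)

lemma measurable_threshold (β₁ : ℝ) : Measurable fun u : Fin n → ℝ => threshold n β₁ u := by
  unfold threshold
  fun_prop

lemma measurable_restrictedWeight (β₂ : ℝ) (τ : Perm (Fin n)) :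
    Measurable fun b : Fin n → ℝ => restrictedWeight n b β₂ τ := by
  unfold restrictedWeight
  refine Measurable.ite ?_ measurable_const measurable_const
  rw [Set.ofPred_forall]
  exact MeasurableSet.iInter fun i => measurableSet_le measurable_const (measurable_pi_apply i)

lemma measurable_restrictedLaw (β₂ : ℝ) (τ : Perm (Fin n)) :
    Measurable fun b : Fin n → ℝ => restrictedLaw n b β₂ τ := by
  unfold restrictedLaw
  exact (measurable_restrictedWeight β₂ τ).div
    (Finset.measurable_fun_sum _ fun ρ _ => measurable_restrictedWeight β₂ ρ)

lemma restrictedLaw_nonneg (b : Fin n → ℝ) (β₂ : ℝ) (τ : Perm (Fin n)) :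
    0 ≤ restrictedLaw n b β₂ τ :=
  div_nonneg (restrictedWeight_nonneg b β₂ τ)
    (Finset.sum_nonneg fun ρ _ => restrictedWeight_nonneg b β₂ ρ)

lemma restrictedLaw_le_one (b : Fin n → ℝ) (β₂ : ℝ) (τ : Perm (Fin n)) :
    restrictedLaw n b β₂ τ ≤ 1 :=
  div_le_one_of_le₀ (Finset.single_le_sum (f := fun ρ => restrictedWeight n b β₂ ρ)
    (fun ρ _ => restrictedWeight_nonneg b β₂ ρ) (mem_univ τ))
    (Finset.sum_nonneg fun ρ _ => restrictedWeight_nonneg b β₂ ρ)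

lemma integrable_restrictedLaw {μ : Measure (Fin n → ℝ)} [IsFiniteMeasure μ]
    {g : (Fin n → ℝ) → Fin n → ℝ} (hg : Measurable g) (β₂ : ℝ) (τ : Perm (Fin n)) :
    Integrable (fun u => restrictedLaw n (g u) β₂ τ) μ := by
  refine Integrable.of_bound ((measurable_restrictedLaw β₂ τ).comp hg).aestronglyMeasurable 1 ?_
  refine Filter.Eventually.of_forall fun u => ?_
  rw [Real.norm_eq_abs, abs_of_nonneg (restrictedLaw_nonneg _ _ _)]
  exact restrictedLaw_le_one _ _ _

lemma measurable_threshold_scale (β₁ : ℝ) (σ : Perm (Fin n)) :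
    Measurable fun u : Fin n → ℝ => threshold n β₁ fun i => auxLength β₁ σ i * u i :=
  (measurable_threshold β₁).comp (measurable_scale _)

lemma transition_mulVec (β₁ β₂ : ℝ) (f : Perm (Fin n) → ℝ) (σ : Perm (Fin n)) :
    (transition n β₁ β₂).mulVec f σ =
      ∫ u, partialMean (threshold n β₁ fun i => auxLength β₁ σ i * u i) β₂ n f
        ∂(Measure.pi fun _ : Fin n => unitLaw) := by
  simp only [partialMean_self]
  rw [integral_finsetSum _ fun τ _ =>
    (integrable_restrictedLaw (measurable_threshold_scale β₁ σ) β₂ τ).mul_const _]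
  simp only [Matrix.mulVec, dotProduct, transition, Matrix.of_apply]
  refine Finset.sum_congr rfl fun τ _ => ?_
  have hm : Measurable fun u => restrictedLaw n (threshold n β₁ u) β₂ τ :=
    (measurable_restrictedLaw β₂ τ).comp (measurable_threshold β₁)
  rw [auxLaw_eq_map, integral_map (measurable_scale _).aemeasurable hm.aestronglyMeasurable,
    integral_mul_const]

lemma threshold_scale {β₁ : ℝ} (hβ : 0 < β₁) (σ : Perm (Fin n)) {u : Fin n → ℝ} {i : Fin n}
    (hu : 0 < u i) :
    threshold n β₁ (fun i => auxLength β₁ σ i * u i) i =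
      max ((σ i : ℕ) : ℝ) ((i : ℕ) : ℝ) - Real.log (u i) / (2 * β₁) := by
  have h : max (((σ i : ℕ) : ℝ) - ((i : ℕ) : ℝ)) 0 =
      max ((σ i : ℕ) : ℝ) ((i : ℕ) : ℝ) - ((i : ℕ) : ℝ) := by
    rw [← max_sub_sub_right, sub_self]
  unfold threshold auxLength
  rw [Real.log_mul (Real.exp_pos _).ne' hu.ne', Real.log_exp, h]
  field_simp
  ring

/-- A weight that is small when the argument is at most `15 / 16`. -/
noncomputable def smallWeight (t : ℝ) : ℝ := if t ≤ 15 / 16 then 1 / 16 else 1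

lemma smallWeight_nonneg (t : ℝ) : 0 ≤ smallWeight t := by unfold smallWeight; split_ifs <;> norm_num

lemma smallWeight_le_one (t : ℝ) : smallWeight t ≤ 1 := by unfold smallWeight; split_ifs <;> norm_num

lemma measurable_smallWeight : Measurable smallWeight :=
  Measurable.ite measurableSet_Iic measurable_const measurable_const

lemma integral_smallWeight_le : ∫ t, smallWeight t ∂unitLaw ≤ 1 / 8 := by
  have h : ∀ t, smallWeight t =
      1 / 16 + (Set.Ioi (15 / 16 : ℝ)).indicator (fun _ => (15 / 16 : ℝ)) t := by
    intro t
    unfold smallWeight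
    by_cases ht : t ≤ 15 / 16
    · simp [ht]
    · rw [if_neg ht, Set.indicator_of_mem (by simpa using ht)]; norm_num
  have hvol : unitLaw.real (Set.Ioi (15 / 16 : ℝ)) ≤ 1 / 16 := by
    have : Set.Ioi (15 / 16 : ℝ) ∩ Set.Icc 0 1 ⊆ Set.Icc (15 / 16) 1 := fun x hx => ⟨hx.1.le, hx.2.2⟩
    rw [Measure.real, unitLaw, Measure.restrict_apply measurableSet_Ioi]
    refine (ENNReal.toReal_mono (by simp) (measure_mono this)).trans ?_
    rw [Real.volume_Icc, ENNReal.toReal_ofReal (by norm_num)]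
    norm_num
  simp only [h]
  rw [integral_add (integrable_const _) ((integrable_const _).indicator measurableSet_Ioi),
    integral_indicator_const _ measurableSet_Ioi]
  simp only [integral_const, smul_eq_mul, probReal_univ, one_mul]
  linarith

/-- A pointwise Chernoff bound. If at least a quarter of the coordinates in `S` are small, the first
term suffices; otherwise the second term is at least one. -/
lemma inv_one_add_card_le {ι : Type*} (S : Finset ι) (u : ι → ℝ) :
    1 / (1 + ((S.filter fun i => u i ≤ 15 / 16).card : ℝ)) ≤
      4 / (4 + (S.card : ℝ)) + 2 ^ S.card * ∏ i ∈ S, smallWeight (u i) := by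
  have hprod : ∏ i ∈ S, smallWeight (u i) =
      (1 / 16) ^ (S.filter fun i => u i ≤ 15 / 16).card := by
    unfold smallWeight
    rw [Finset.prod_ite]
    simp
  rw [hprod]
  set B := (S.filter fun i => u i ≤ 15 / 16).card
  by_cases h : S.card ≤ 4 * B
  · have h' : (S.card : ℝ) ≤ 4 * B := by exact_mod_cast h
    have : 1 / (1 + (B : ℝ)) ≤ 4 / (4 + (S.card : ℝ)) := by
      rw [div_le_div_iff₀ (by positivity) (by positivity)]; linarith
    have h2 : (0 : ℝ) ≤ 2 ^ S.card * (1 / 16) ^ B := by positivity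
    linarith
  · have h1 : (16 : ℝ) ^ B ≤ 2 ^ S.card := by
      calc (16 : ℝ) ^ B = 2 ^ (4 * B) := by rw [pow_mul]; norm_num
        _ ≤ 2 ^ S.card := pow_le_pow_right₀ (by norm_num) (not_le.1 h).le
    have h2 : (1 : ℝ) ≤ 2 ^ S.card * (1 / 16) ^ B := by
      rw [one_div, inv_pow, ← div_eq_mul_inv, le_div_iff₀ (by positivity)]; linarith
    have h3 : 1 / (1 + (B : ℝ)) ≤ 1 := by
      rw [div_le_one (by positivity)]; linarith [Nat.cast_nonneg (α := ℝ) B]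
    have h4 : (0 : ℝ) ≤ 4 / (4 + (S.card : ℝ)) := by positivity
    linarith

/-- Independence of coordinates. The integrand is padded with factors `1` to become a product over
all coordinates. -/
lemma integral_mul_prod_pi {μ : Measure ℝ} [IsProbabilityMeasure μ] (s g : ℝ → ℝ) {i₀ : Fin n}
    {S : Finset (Fin n)} (hi₀ : i₀ ∉ S) :
    ∫ u, s (u i₀) * ∏ i ∈ S, g (u i) ∂(Measure.pi fun _ : Fin n => μ) =
      (∫ t, s t ∂μ) * (∫ t, g t ∂μ) ^ S.card := by
  have key : ∀ F : Fin n → ℝ, ∀ a : ℝ,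
      ∏ k, (if k = i₀ then a else if k ∈ S then F k else 1) = a * ∏ k ∈ S, F k := by
    intro F a
    rw [← Finset.mul_prod_erase univ _ (mem_univ i₀), if_pos rfl]
    congr 1
    have hsub : S ⊆ univ.erase i₀ := fun i hi =>
      mem_erase.2 ⟨ne_of_mem_of_not_mem hi hi₀, mem_univ _⟩
    rw [← Finset.prod_subset hsub]
    · refine Finset.prod_congr rfl fun i hi => ?_
      rw [if_neg (ne_of_mem_of_not_mem hi hi₀), if_pos hi]
    · intro i hi hiS
      rw [if_neg (mem_erase.1 hi).1, if_neg hiS]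
  have h := integral_fintype_prod_eq_prod (μ := fun _ : Fin n => μ)
    (fun k t => if k = i₀ then s t else if k ∈ S then g t else (1 : ℝ))
  have e : (fun u : Fin n → ℝ => s (u i₀) * ∏ i ∈ S, g (u i)) =
      fun u => ∏ k, (if k = i₀ then s (u k) else if k ∈ S then g (u k) else 1) := by
    funext u
    rw [← key (fun k => g (u k)) (s (u i₀))]
    refine Finset.prod_congr rfl fun k _ => ?_
    by_cases hk : k = i₀
    · simp [hk]
    · simp [hk]
  rw [e, h]
  rw [← Finset.prod_const, ← key (fun _ => ∫ t, g t ∂μ) (∫ t, s t ∂μ)]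
  refine Finset.prod_congr rfl fun k _ => ?_
  by_cases hk : k = i₀ <;> by_cases hS : k ∈ S <;> simp [hk, hS]

lemma separates_nonneg (v x y : ℝ) : 0 ≤ separates v x y := by
  unfold separates; split_ifs <;> norm_num

lemma separates_le_one (v x y : ℝ) : separates v x y ≤ 1 := by
  unfold separates; split_ifs <;> norm_num

lemma separates_comm (v x y : ℝ) : separates v x y = separates v y x := by
  unfold separates; simp only [iff_comm]

lemma measurable_separates {α : Type*} [MeasurableSpace α] (v : ℝ) {x y : α → ℝ}
    (hx : Measurable x) (hy : Measurable y) : Measurable fun t => separates v (x t) (y t) := by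
  unfold separates
  refine Measurable.ite ?_ measurable_const measurable_const
  exact (measurableSet_le measurable_const hx).iff (measurableSet_le measurable_const hy)

/-- For `x ≤ y`, separation forces `t` into an interval `(p, q]` with `p = q * exp (-(2 * β * (y -
x)))`. -/
lemma integral_separates_le {β : ℝ} (hβ : 0 < β) (v x y : ℝ) :
    ∫ t, separates v (x - Real.log t / (2 * β)) (y - Real.log t / (2 * β)) ∂unitLaw ≤
      2 * β * |x - y| := by
  wlog hxy : x ≤ y generalizing x y
  · have := this y x (le_of_not_ge hxy)
    simp only [separates_comm v (y - _)] at this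
    rwa [abs_sub_comm] at this
  set p := Real.exp (-(2 * β * (v - x))) with hp
  set q := Real.exp (-(2 * β * (v - y))) with hq
  have hle : ∀ᵐ t ∂unitLaw, separates v (x - Real.log t / (2 * β)) (y - Real.log t / (2 * β)) ≤
      (Set.Ioc p q).indicator (fun _ => (1 : ℝ)) t := by
    filter_upwards [unitLaw_ae] with t ht
    by_cases h : t ∈ Set.Ioc p q
    · rw [Set.indicator_of_mem h]; exact separates_le_one _ _ _
    · rw [Set.indicator_of_notMem h]
      unfold separates
      rw [if_pos]
      constructor
      · intro h'; linarith
      · intro h'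
        by_contra hlt
        apply h
        have h1 : Real.log t / (2 * β) ≤ y - v := by linarith
        have h2 : x - v < Real.log t / (2 * β) := by linarith
        rw [div_le_iff₀ (by positivity)] at h1
        rw [lt_div_iff₀ (by positivity)] at h2
        constructor
        · rw [hp, ← Real.lt_log_iff_exp_lt ht.1]; linarith
        · rw [hq, ← Real.log_le_iff_le_exp ht.1]; linarith
  have hpq : p = q * Real.exp (-(2 * β * (y - x))) := by
    rw [hp, hq, ← Real.exp_add]; ring_nf
  have hE := Real.add_one_le_exp (-(2 * β * (y - x)))
  have hE1 : Real.exp (-(2 * β * (y - x))) ≤ 1 := by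
    rw [Real.exp_le_one_iff]
    have : 0 ≤ 2 * β * (y - x) := mul_nonneg (by positivity) (by linarith)
    linarith
  have hq0 : 0 < q := Real.exp_pos _
  have hvol : unitLaw.real (Set.Ioc p q) ≤ 2 * β * (y - x) := by
    have hsub : Set.Ioc p q ∩ Set.Icc 0 1 ⊆ Set.Icc p (min q 1) :=
      fun t ht => ⟨ht.1.1.le, le_min ht.1.2 ht.2.2⟩
    rw [Measure.real, unitLaw, Measure.restrict_apply measurableSet_Ioc]
    refine (ENNReal.toReal_mono (by simp) (measure_mono hsub)).trans ?_
    rw [Real.volume_Icc]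
    rw [ENNReal.toReal_ofReal']
    refine max_le ?_ (mul_nonneg (by positivity) (by linarith))
    -- With `E` the exponential, `min q 1 - q * E ≤ min q 1 * (1 - E) ≤ 1 - E`, and `1 - E` is at
    -- most the exponent in absolute value.
    have hm0 : 0 < min q 1 := lt_min hq0 one_pos
    have hm1 : min q 1 ≤ 1 := min_le_right _ _
    have hmq : min q 1 ≤ q := min_le_left _ _
    rw [hpq]
    nlinarith [Real.exp_pos (-(2 * β * (y - x)))]
  calc _ ≤ ∫ t, (Set.Ioc p q).indicator (fun _ => (1 : ℝ)) t ∂unitLaw :=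
        integral_mono_of_nonneg (Filter.Eventually.of_forall fun t => separates_nonneg _ _ _)
          ((integrable_const _).indicator measurableSet_Ioc) hle
    _ = unitLaw.real (Set.Ioc p q) := by
        rw [integral_indicator_const _ measurableSet_Ioc]; simp
    _ ≤ _ := by rw [abs_sub_comm, abs_of_nonneg (by linarith)]; exact hvol

/-- The event that the choice probabilities at a given step change because of coordinate `i₀`,
times a bound on the amount of the change. -/
noncomputable def stepBound (s : ℝ → ℝ) (i₀ : Fin n) (S : Finset (Fin n)) (u : Fin n → ℝ) : ℝ :=
  s (u i₀) * (4 / (4 + (S.card : ℝ)) + 2 ^ S.card * ∏ i ∈ S, smallWeight (u i))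

lemma integrable_stepBound {s : ℝ → ℝ} (hs : Measurable s) (h0 : ∀ t, 0 ≤ s t)
    (h1 : ∀ t, s t ≤ 1) (i₀ : Fin n) (S : Finset (Fin n)) :
    Integrable (stepBound s i₀ S) (Measure.pi fun _ : Fin n => unitLaw) := by
  have hP : Measurable fun u : Fin n → ℝ => ∏ i ∈ S, smallWeight (u i) :=
    Finset.measurable_fun_prod _ fun i _ => measurable_smallWeight.comp (measurable_pi_apply i)
  have hm : Measurable (stepBound s i₀ S) :=
    (hs.comp (measurable_pi_apply i₀)).mul ((hP.const_mul _).const_add _)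
  refine Integrable.of_bound hm.aestronglyMeasurable
    (1 * (4 / (4 + (S.card : ℝ)) + 2 ^ S.card * 1)) (Filter.Eventually.of_forall fun u => ?_)
  have hP0 : 0 ≤ ∏ i ∈ S, smallWeight (u i) := Finset.prod_nonneg fun i _ => smallWeight_nonneg _
  have hP1 : ∏ i ∈ S, smallWeight (u i) ≤ 1 :=
    Finset.prod_le_one (fun i _ => smallWeight_nonneg _) fun i _ => smallWeight_le_one _
  have h0' := h0 (u i₀)
  rw [Real.norm_eq_abs, stepBound, abs_of_nonneg (by positivity)]
  have h1' := h1 (u i₀)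
  gcongr

/-- Since `i₀ ∉ S`, the factor `s (u i₀)` is independent of the rest. The constant is `6 = 4 + 2`:
the main term gives `4`, and the Chernoff term, of mean at most `(2 / 8) ^ S.card`, gives `2`. -/
lemma integral_stepBound_le {s : ℝ → ℝ} (hs : Measurable s) (h0 : ∀ t, 0 ≤ s t)
    (h1 : ∀ t, s t ≤ 1) {i₀ : Fin n} {S : Finset (Fin n)} (hi₀ : i₀ ∉ S) :
    ((S.card : ℝ) + 2) * ∫ u, stepBound s i₀ S u ∂(Measure.pi fun _ : Fin n => unitLaw) ≤
      6 * ∫ t, s t ∂unitLaw := by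
  have hcomp : Integrable (fun u : Fin n → ℝ => s (u i₀)) (Measure.pi fun _ : Fin n => unitLaw) := by
    refine Integrable.of_bound (hs.comp (measurable_pi_apply i₀)).aestronglyMeasurable 1 ?_
    exact Filter.Eventually.of_forall fun u => by
      rw [Real.norm_eq_abs, abs_of_nonneg (h0 _)]; exact h1 _
  have e : stepBound s i₀ S = fun u => s (u i₀) * (4 / (4 + (S.card : ℝ))) +
      2 ^ S.card * (s (u i₀) * ∏ i ∈ S, smallWeight (u i)) := by
    funext u; unfold stepBound; ring
  have hint2 : Integrable (fun u => 2 ^ S.card * (s (u i₀) * ∏ i ∈ S, smallWeight (u i)))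
      (Measure.pi fun _ : Fin n => unitLaw) := by
    have := (integrable_stepBound hs h0 h1 i₀ S).sub (hcomp.mul_const (4 / (4 + (S.card : ℝ))))
    refine this.congr (Filter.Eventually.of_forall fun u => ?_)
    simp only [e, Pi.sub_apply]; ring
  have hs0 : 0 ≤ ∫ t, s t ∂unitLaw := integral_nonneg h0
  have hone : ∫ u, s (u i₀) ∂(Measure.pi fun _ : Fin n => unitLaw) = ∫ t, s t ∂unitLaw := by
    simpa using integral_mul_prod_pi (n := n) (μ := unitLaw) s (fun _ => 1) (i₀ := i₀)
      (S := ∅) (by simp)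
  rw [e, integral_add (hcomp.mul_const _) hint2, integral_mul_const, integral_const_mul,
    integral_mul_prod_pi s smallWeight hi₀, hone]
  have hw0 : 0 ≤ ∫ t, smallWeight t ∂unitLaw := integral_nonneg smallWeight_nonneg
  have hpow : (2 : ℝ) ^ S.card * (∫ t, smallWeight t ∂unitLaw) ^ S.card ≤ (1 / 4) ^ S.card := by
    rw [← mul_pow]
    exact pow_le_pow_left₀ (by positivity) (by linarith [integral_smallWeight_le]) _
  have hm : ((S.card : ℝ) + 2) * (1 / 4) ^ S.card ≤ 2 := by
    have hB : ((S.card : ℝ) + 2) ≤ 2 * 4 ^ S.card := by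
      have : S.card < 2 ^ S.card := Nat.lt_two_pow_self
      have h2 : (2 : ℝ) ^ S.card ≤ 4 ^ S.card := pow_le_pow_left₀ (by norm_num) (by norm_num) _
      have h3 : (S.card : ℝ) + 1 ≤ 2 ^ S.card := by exact_mod_cast this
      have h4 : (1 : ℝ) ≤ 4 ^ S.card := one_le_pow₀ (by norm_num)
      linarith
    rw [one_div, inv_pow, ← div_eq_mul_inv, div_le_iff₀ (by positivity)]
    exact hB
  have hq : ((S.card : ℝ) + 2) * (4 / (4 + (S.card : ℝ))) ≤ 4 := by
    rw [mul_div_assoc', div_le_iff₀ (by positivity)]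
    linarith [Nat.cast_nonneg (α := ℝ) S.card]
  set I := ∫ t, s t ∂unitLaw
  set w := ∫ t, smallWeight t ∂unitLaw
  have hc : (0 : ℝ) ≤ (S.card : ℝ) + 2 := by positivity
  calc ((S.card : ℝ) + 2) * (I * (4 / (4 + (S.card : ℝ))) + 2 ^ S.card * (I * w ^ S.card))
      = (((S.card : ℝ) + 2) * (4 / (4 + (S.card : ℝ))) +
          ((S.card : ℝ) + 2) * (2 ^ S.card * w ^ S.card)) * I := by ring
    _ ≤ (4 + 2) * I := by
        refine mul_le_mul_of_nonneg_right (add_le_add hq ?_) hs0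
        exact (mul_le_mul_of_nonneg_left hpow hc).trans hm
    _ = 6 * I := by ring

end TwistedHitAndRun

/-! ### Contraction of the Lipschitz constant in one step. -/

namespace TwistedHitAndRun

open Equiv Finset MeasureTheory

variable {n : ℕ} {β₁ β₂ : ℝ}

lemma pi_unitLaw_ae : ∀ᵐ u ∂(Measure.pi fun _ : Fin n => unitLaw), ∀ i, 0 < u i ∧ u i ≤ 1 := by
  rw [ae_all_iff]
  intro i
  exact (Measure.tendsto_eval_ae_ae (μ := fun _ : Fin n => unitLaw) (i := i)).eventually unitLaw_ae

/-- The thresholds when the auxiliary variables are obtained by scaling uniform variables `u`. -/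
noncomputable def scaledThreshold (β₁ : ℝ) (σ : Perm (Fin n)) (u : Fin n → ℝ) : Fin n → ℝ :=
  threshold n β₁ fun i => auxLength β₁ σ i * u i

lemma le_scaledThreshold (hβ : 0 < β₁) (σ : Perm (Fin n)) {u : Fin n → ℝ}
    (hu : ∀ i, 0 < u i ∧ u i ≤ 1) (i : Fin n) : ((i : ℕ) : ℝ) ≤ scaledThreshold β₁ σ u i := by
  rw [scaledThreshold, threshold_scale hβ σ (hu i).1]
  have h1 : Real.log (u i) / (2 * β₁) ≤ 0 :=
    div_nonpos_of_nonpos_of_nonneg (Real.log_nonpos (hu i).1.le (hu i).2) (by positivity)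
  have h2 : ((i : ℕ) : ℝ) ≤ max ((σ i : ℕ) : ℝ) ((i : ℕ) : ℝ) := le_max_right _ _
  linarith

lemma le_scaledThreshold_of_small (hβ : 0 < β₁) (hc : β₁ ≤ 1 / 100 / (n : ℝ)) (σ : Perm (Fin n))
    {u : Fin n → ℝ} (hu : ∀ i, 0 < u i ∧ u i ≤ 1) {i : Fin n} (hi : u i ≤ 15 / 16) (v : Fin n) :
    ((v : ℕ) : ℝ) ≤ scaledThreshold β₁ σ u i := by
  have hn : (0 : ℝ) < n := by exact_mod_cast (Nat.zero_le _).trans_lt v.2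
  have hvn : ((v : ℕ) : ℝ) ≤ n := by exact_mod_cast v.2.le
  rw [scaledThreshold, threshold_scale hβ σ (hu i).1]
  have hlog := Real.log_le_sub_one_of_pos (hu i).1
  rw [le_div_iff₀ hn] at hc
  -- Here `log (u i) ≤ -1 / 16`, while `2 * β₁ * n ≤ 1 / 50`.
  have h1 : Real.log (u i) / (2 * β₁) ≤ -n := by
    rw [div_le_iff₀ (by positivity)]
    nlinarith
  have h2 : (0 : ℝ) ≤ max ((σ i : ℕ) : ℝ) ((i : ℕ) : ℝ) := le_max_of_le_right (by positivity)
  linarith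

/-- The smaller labels than `w`, without `i₀` and `j₀`. -/
def smaller (i₀ j₀ w : Fin n) : Finset (Fin n) := ((Iio w).erase i₀).erase j₀

/-- Both exceptional positions are dropped to keep independence; the loss of two is absorbed by the
`+ 2` in `integral_stepBound_le`. -/
lemma le_card_smaller (i₀ j₀ w : Fin n) : (w : ℕ) ≤ (smaller i₀ j₀ w).card + 2 := by
  have h1 := Finset.pred_card_le_card_erase (s := Iio w) (a := i₀)
  have h2 := Finset.pred_card_le_card_erase (s := (Iio w).erase i₀) (a := j₀)
  rw [Fin.card_Iio] at h1
  unfold smaller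
  omega

/-- The indicator that the `i`-th thresholds of two permutations lie on different sides of `w`,
as a function of the `i`-th uniform variable. -/
noncomputable def thresholdSeparates (β₁ : ℝ) (σ σ' : Perm (Fin n)) (w i : Fin n) (t : ℝ) : ℝ :=
  separates (w : ℕ) (max ((σ i : ℕ) : ℝ) ((i : ℕ) : ℝ) - Real.log t / (2 * β₁))
    (max ((σ' i : ℕ) : ℝ) ((i : ℕ) : ℝ) - Real.log t / (2 * β₁))

lemma measurable_thresholdSeparates (σ σ' : Perm (Fin n)) (w i : Fin n) :
    Measurable (thresholdSeparates β₁ σ σ' w i) :=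
  measurable_separates _ (by fun_prop) (by fun_prop)

lemma integral_thresholdSeparates_le (hβ : 0 < β₁) (σ σ' : Perm (Fin n)) (w i : Fin n) :
    ∫ t, thresholdSeparates β₁ σ σ' w i t ∂unitLaw ≤
      2 * β₁ * |((σ i : ℕ) : ℝ) - ((σ' i : ℕ) : ℝ)| := by
  refine (integral_separates_le hβ _ _ _).trans ?_
  exact mul_le_mul_of_nonneg_left (abs_max_sub_max_le_abs _ _ _) (by positivity)

lemma ExchangeLip.abs_partialMean_scaledThreshold_sub_le {D : ℝ} {f : Perm (Fin n) → ℝ}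
    (hf : ExchangeLip D f) (hD : 0 ≤ D) (hβ : 0 < β₁) (hc : β₁ ≤ 1 / 100 / (n : ℝ))
    (hβ₂ : 0 ≤ β₂) {σ σ' : Perm (Fin n)} {i₀ j₀ : Fin n} (hij : i₀ ≠ j₀)
    (hσ : ∀ i, i ≠ i₀ → i ≠ j₀ → σ i = σ' i) {u : Fin n → ℝ} (hu : ∀ i, 0 < u i ∧ u i ≤ 1) :
    |partialMean (scaledThreshold β₁ σ u) β₂ n f - partialMean (scaledThreshold β₁ σ' u) β₂ n f| ≤
      ∑ w : Fin n, 2 * D * ((w : ℕ) : ℝ) *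
        (stepBound (thresholdSeparates β₁ σ σ' w i₀) i₀ (smaller i₀ j₀ w) u +
          stepBound (thresholdSeparates β₁ σ σ' w j₀) j₀ (smaller i₀ j₀ w) u) := by
  have hb := le_scaledThreshold hβ σ hu
  have hb' := le_scaledThreshold hβ σ' hu
  have h := ExchangeLip.abs_partialMean_sub_le (β₂ := β₂) hD hb hb' n le_rfl f hf
  rw [Finset.filter_true_of_mem (fun w _ => w.2)] at h
  refine h.trans (Finset.sum_le_sum fun w _ => ?_)
  have h1 := sum_abs_stepProb_sub_le hβ₂ hb hb' w (smaller i₀ j₀ w)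
    (fun i hi => by simp only [smaller, mem_erase, mem_Iio] at hi; exact hi.2.2)
  have hsep : ∀ i, separates (w : ℕ) (scaledThreshold β₁ σ u i) (scaledThreshold β₁ σ' u i) =
      thresholdSeparates β₁ σ σ' w i (u i) := by
    intro i
    simp only [scaledThreshold, threshold_scale hβ _ (hu i).1, thresholdSeparates]
  have hsum : ∑ i, separates (w : ℕ) (scaledThreshold β₁ σ u i) (scaledThreshold β₁ σ' u i) =
      thresholdSeparates β₁ σ σ' w i₀ (u i₀) + thresholdSeparates β₁ σ σ' w j₀ (u j₀) := by
    simp only [hsep]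
    rw [← Finset.sum_pair (f := fun i => thresholdSeparates β₁ σ σ' w i (u i)) hij]
    symm
    refine Finset.sum_subset (subset_univ _) fun i _ hi => ?_
    simp only [mem_insert, mem_singleton, not_or] at hi
    simp [thresholdSeparates, separates, hσ i hi.1 hi.2]
  rw [hsum] at h1
  have hs0 : ∀ i, 0 ≤ thresholdSeparates β₁ σ σ' w i (u i) := fun i => separates_nonneg _ _ _
  have hcard : ((smaller i₀ j₀ w).filter fun i => u i ≤ 15 / 16).card ≤
      ((smaller i₀ j₀ w).filter fun i => ((w : ℕ) : ℝ) ≤ scaledThreshold β₁ σ u i).card := by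
    refine Finset.card_le_card fun i hi => ?_
    rw [mem_filter] at hi ⊢
    exact ⟨hi.1, le_scaledThreshold_of_small hβ hc σ hu hi.2 w⟩
  have hcard' : (((smaller i₀ j₀ w).filter fun i => u i ≤ 15 / 16).card : ℝ) ≤
      ((smaller i₀ j₀ w).filter fun i => ((w : ℕ) : ℝ) ≤ scaledThreshold β₁ σ u i).card := by
    exact_mod_cast hcard
  have h2 := inv_one_add_card_le (smaller i₀ j₀ w) u
  set X := thresholdSeparates β₁ σ σ' w i₀ (u i₀) + thresholdSeparates β₁ σ σ' w j₀ (u j₀)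
    with hX
  have hX0 : 0 ≤ X := add_nonneg (hs0 _) (hs0 _)
  have h3 : 1 / (1 + (((smaller i₀ j₀ w).filter
      fun i => ((w : ℕ) : ℝ) ≤ scaledThreshold β₁ σ u i).card : ℝ)) ≤
      1 / (1 + (((smaller i₀ j₀ w).filter fun i => u i ≤ 15 / 16).card : ℝ)) := by
    gcongr
  calc D * ((w : ℕ) : ℝ) * ∑ i, |stepProb (scaledThreshold β₁ σ u) β₂ w i -
          stepProb (scaledThreshold β₁ σ' u) β₂ w i|
      ≤ D * ((w : ℕ) : ℝ) * (2 * X * (4 / (4 + ((smaller i₀ j₀ w).card : ℝ)) +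
          2 ^ (smaller i₀ j₀ w).card * ∏ i ∈ smaller i₀ j₀ w, smallWeight (u i))) := by
        refine mul_le_mul_of_nonneg_left (h1.trans ?_) (by positivity)
        rw [div_eq_mul_one_div]
        exact mul_le_mul_of_nonneg_left (h3.trans h2) (by positivity)
    _ = _ := by rw [hX]; unfold stepBound; ring

lemma ExchangeLip.transition_mulVec {D : ℝ} {f : Perm (Fin n) → ℝ}
    (hf : ExchangeLip D f) (hD : 0 ≤ D) (hβ : 0 < β₁) (hc : β₁ ≤ 1 / 100 / (n : ℝ))
    (hβ₂ : 0 ≤ β₂) : ExchangeLip (D / 2) ((transition n β₁ β₂).mulVec f) := by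
  intro a b σ
  by_cases hab : a = b
  · subst hab; simp [swap_self, ← Perm.one_def]
  set σ' := swap a b * σ with hσ'
  set i₀ := σ⁻¹ a
  set j₀ := σ⁻¹ b
  have hi₀ : σ i₀ = a := σ.apply_symm_apply a
  have hj₀ : σ j₀ = b := σ.apply_symm_apply b
  have hij : i₀ ≠ j₀ := fun h => hab (by rw [← hi₀, ← hj₀, h])
  have hσi : σ' i₀ = b := by simp [hσ', hi₀]
  have hσj : σ' j₀ = a := by simp [hσ', hj₀]
  have hother : ∀ i, i ≠ i₀ → i ≠ j₀ → σ' i = σ i := by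
    intro i h1 h2
    rw [hσ', Perm.mul_apply, swap_apply_of_ne_of_ne]
    · exact fun h => h1 (σ.injective (h.trans hi₀.symm))
    · exact fun h => h2 (σ.injective (h.trans hj₀.symm))
  set P := Measure.pi fun _ : Fin n => unitLaw with hP
  have hn : (0 : ℝ) < n := by exact_mod_cast (Nat.zero_le _).trans_lt a.2
  have hint : ∀ τ : Perm (Fin n),
      Integrable (fun u => partialMean (scaledThreshold β₁ τ u) β₂ n f) P := by
    intro τ
    simp only [partialMean_self]
    exact integrable_finsetSum _ fun ρ _ =>
      (integrable_restrictedLaw (measurable_threshold_scale β₁ τ) β₂ ρ).mul_const _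
  set d := |((a : ℕ) : ℝ) - ((b : ℕ) : ℝ)| with hd
  have hs0 : ∀ w i t, 0 ≤ thresholdSeparates β₁ σ' σ w i t := fun _ _ _ => separates_nonneg _ _ _
  have hs1 : ∀ w i t, thresholdSeparates β₁ σ' σ w i t ≤ 1 := fun _ _ _ => separates_le_one _ _ _
  have hsi : ∀ w k, Integrable
      (stepBound (thresholdSeparates β₁ σ' σ w k) k (smaller i₀ j₀ w)) P := fun w k =>
    integrable_stepBound (measurable_thresholdSeparates _ _ _ _) (hs0 w k) (hs1 w k) _ _
  -- The cost `w` of a changed choice cancels against the normalizer, leaving a bound uniform in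
  -- `w`; `12` is `6` times the `2` of the separation probability.
  have hstep : ∀ w k, k ∉ smaller i₀ j₀ w → |((σ' k : ℕ) : ℝ) - ((σ k : ℕ) : ℝ)| = d →
      ((w : ℕ) : ℝ) * ∫ u, stepBound (thresholdSeparates β₁ σ' σ w k) k (smaller i₀ j₀ w) u ∂P ≤
        12 * β₁ * d := by
    intro w k hk hkd
    have h1 := integral_stepBound_le (measurable_thresholdSeparates (β₁ := β₁) σ' σ w k)
      (hs0 w k) (hs1 w k) hk
    have h2 := integral_thresholdSeparates_le hβ σ' σ w k
    rw [hkd] at h2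
    have h3 : ((w : ℕ) : ℝ) ≤ ((smaller i₀ j₀ w).card : ℝ) + 2 := by
      exact_mod_cast le_card_smaller i₀ j₀ w
    have h4 : 0 ≤ ∫ u, stepBound (thresholdSeparates β₁ σ' σ w k) k (smaller i₀ j₀ w) u ∂P := by
      refine integral_nonneg fun u => mul_nonneg (hs0 w k _) ?_
      have := Finset.prod_nonneg (s := smaller i₀ j₀ w) fun i _ => smallWeight_nonneg (u i)
      positivity
    calc _ ≤ _ := mul_le_mul_of_nonneg_right h3 h4
      _ ≤ _ := h1
      _ ≤ 12 * β₁ * d := by linarith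
  rw [TwistedHitAndRun.transition_mulVec, TwistedHitAndRun.transition_mulVec]
  change |∫ u, partialMean (scaledThreshold β₁ σ' u) β₂ n f ∂P -
    ∫ u, partialMean (scaledThreshold β₁ σ u) β₂ n f ∂P| ≤ _
  rw [← integral_sub (hint _) (hint _)]
  calc _ ≤ ∫ u, |partialMean (scaledThreshold β₁ σ' u) β₂ n f -
          partialMean (scaledThreshold β₁ σ u) β₂ n f| ∂P := abs_integral_le_integral_abs
    _ ≤ ∫ u, ∑ w : Fin n, 2 * D * ((w : ℕ) : ℝ) *
        (stepBound (thresholdSeparates β₁ σ' σ w i₀) i₀ (smaller i₀ j₀ w) u +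
          stepBound (thresholdSeparates β₁ σ' σ w j₀) j₀ (smaller i₀ j₀ w) u) ∂P := by
        refine integral_mono_of_nonneg (Filter.Eventually.of_forall fun u => abs_nonneg _)
          (integrable_finsetSum _ fun w _ => ((hsi w i₀).add (hsi w j₀)).const_mul _) ?_
        filter_upwards [pi_unitLaw_ae] with u hu
        exact hf.abs_partialMean_scaledThreshold_sub_le hD hβ hc hβ₂ hij hother hu
    _ = ∑ w : Fin n, 2 * D * (((w : ℕ) : ℝ) *
          ∫ u, stepBound (thresholdSeparates β₁ σ' σ w i₀) i₀ (smaller i₀ j₀ w) u ∂P +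
        ((w : ℕ) : ℝ) *
          ∫ u, stepBound (thresholdSeparates β₁ σ' σ w j₀) j₀ (smaller i₀ j₀ w) u ∂P) := by
        refine (integral_finsetSum _ fun w _ =>
          ((hsi w i₀).add (hsi w j₀)).const_mul _).trans ?_
        refine Finset.sum_congr rfl fun w _ => ?_
        simp only [Pi.add_apply]
        rw [integral_const_mul, integral_add (hsi w i₀) (hsi w j₀)]
        ring
    _ ≤ ∑ w : Fin n, 2 * D * (12 * β₁ * d + 12 * β₁ * d) := by
        refine Finset.sum_le_sum fun w _ => mul_le_mul_of_nonneg_left ?_ (by positivity)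
        refine add_le_add (hstep w i₀ (by simp [smaller]) ?_) (hstep w j₀ (by simp [smaller]) ?_)
        · rw [hσi, hi₀, abs_sub_comm]
        · rw [hσj, hj₀]
    _ = 48 * (β₁ * n) * (D * d) := by
        rw [Finset.sum_const, card_univ, Fintype.card_fin, nsmul_eq_mul]; ring
    _ ≤ 48 * (1 / 100) * (D * d) := by
        rw [le_div_iff₀ hn] at hc
        have : 0 ≤ D * d := mul_nonneg hD (abs_nonneg _)
        gcongr
    _ ≤ D / 2 * d := by
        have : 0 ≤ D * d := mul_nonneg hD (abs_nonneg _)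
        linarith

end TwistedHitAndRun

/-! ### Stationarity of the model. -/

namespace TwistedHitAndRun

open Equiv Finset MeasureTheory

variable {n : ℕ} {β₁ β₂ : ℝ}

lemma auxLength_le_one (hβ : 0 < β₁) (σ : Perm (Fin n)) (i : Fin n) : auxLength β₁ σ i ≤ 1 := by
  unfold auxLength
  rw [Real.exp_le_one_iff]
  have : 0 ≤ β₁ * max (((σ i : ℕ) : ℝ) - ((i : ℕ) : ℝ)) 0 :=
    mul_nonneg hβ.le (le_max_right _ _)
  linarith

/-- The box from which the auxiliary variables are drawn. -/
def auxBox (β₁ : ℝ) (σ : Perm (Fin n)) : Set (Fin n → ℝ) :=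
  Set.univ.pi fun i => Set.Icc 0 (auxLength β₁ σ i)

lemma measurableSet_auxBox (σ : Perm (Fin n)) : MeasurableSet (auxBox β₁ σ) :=
  MeasurableSet.univ_pi fun _ => measurableSet_Icc

lemma auxLaw_eq_smul_restrict (σ : Perm (Fin n)) :
    auxLaw n β₁ σ =
      (∏ i, (ENNReal.ofReal (auxLength β₁ σ i))⁻¹) • volume.restrict (auxBox β₁ σ) := by
  refine Measure.pi_eq fun s hs => ?_
  rw [Measure.smul_apply, Measure.restrict_apply (MeasurableSet.univ_pi hs), auxBox,
    ← Set.pi_inter_distrib, volume_pi_pi, smul_eq_mul, ← Finset.prod_mul_distrib]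
  refine Finset.prod_congr rfl fun i _ => ?_
  rw [ProbabilityTheory.cond_apply measurableSet_Icc, Real.volume_Icc, sub_zero, Set.inter_comm]
  rfl

lemma transition_apply (σ σ' : Perm (Fin n)) :
    (∏ i, auxLength β₁ σ i) * transition n β₁ β₂ σ σ' =
      ∫ u in auxBox β₁ σ, restrictedLaw n (threshold n β₁ u) β₂ σ' := by
  have h : (∏ i, (ENNReal.ofReal (auxLength β₁ σ i))⁻¹).toReal = (∏ i, auxLength β₁ σ i)⁻¹ := by
    rw [ENNReal.toReal_prod, ← Finset.prod_inv_distrib]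
    refine Finset.prod_congr rfl fun i _ => ?_
    rw [ENNReal.toReal_inv, ENNReal.toReal_ofReal (auxLength_pos _ _ _).le]
  have hpos : (∏ i, auxLength β₁ σ i) ≠ 0 :=
    (Finset.prod_pos fun i _ => auxLength_pos β₁ σ i).ne'
  rw [transition, Matrix.of_apply, auxLaw_eq_smul_restrict, integral_smul_measure, h, smul_eq_mul,
    mul_inv_cancel_left₀ hpos]

/-- The displacements `σ i - i` sum to zero, so the footrule is twice the sum of their positive
parts, and the weight becomes a box volume. -/
lemma modelWeight_eq (σ : Perm (Fin n)) :
    modelWeight n β₁ β₂ σ =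
      Real.exp (β₂ * (numCycles σ : ℝ)) * ∏ i, auxLength β₁ σ i := by
  have h0 : ∑ i, (((σ i : ℕ) : ℝ) - ((i : ℕ) : ℝ)) = 0 := by
    rw [Finset.sum_sub_distrib, Equiv.sum_comp σ fun i : Fin n => ((i : ℕ) : ℝ), sub_self]
  have h1 : l1Dist σ 1 = ∑ i, 2 * max (((σ i : ℕ) : ℝ) - ((i : ℕ) : ℝ)) 0 := by
    suffices h : l1Dist σ 1 + ∑ i, (((σ i : ℕ) : ℝ) - ((i : ℕ) : ℝ)) =
        ∑ i, 2 * max (((σ i : ℕ) : ℝ) - ((i : ℕ) : ℝ)) 0 by rwa [h0, add_zero] at h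
    rw [l1Dist, ← Finset.sum_add_distrib]
    refine Finset.sum_congr rfl fun i _ => ?_
    rw [Perm.one_apply]
    rcases le_total (((σ i : ℕ) : ℝ) - ((i : ℕ) : ℝ)) 0 with h | h
    · rw [abs_of_nonpos h, max_eq_right h]; ring
    · rw [abs_of_nonneg h, max_eq_left h]; ring
  unfold modelWeight auxLength
  rw [← Real.exp_sum, ← Real.exp_add, h1, Finset.mul_sum, add_comm]
  congr 2
  exact Finset.sum_congr rfl fun i _ => by ring

lemma pi_unitLaw_restrict_auxBox (hβ : 0 < β₁) (σ : Perm (Fin n)) :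
    (Measure.pi fun _ : Fin n => unitLaw).restrict (auxBox β₁ σ) =
      volume.restrict (auxBox β₁ σ) := by
  have h : (Measure.pi fun _ : Fin n => unitLaw) =
      volume.restrict (Set.univ.pi fun _ => Set.Icc 0 1) := by
    rw [volume_pi, Measure.restrict_pi_pi]; rfl
  rw [h, Measure.restrict_restrict (measurableSet_auxBox σ), Set.inter_eq_left.2]
  exact Set.pi_mono fun i _ => Set.Icc_subset_Icc_right (auxLength_le_one hβ σ i)

/-- The positive part is harmless: if `σ i ≤ i`, both sides hold automatically because `u i ≤ 1`. -/
lemma mem_auxBox_iff (hβ : 0 < β₁) (σ : Perm (Fin n)) {u : Fin n → ℝ}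
    (hu : ∀ i, 0 < u i ∧ u i ≤ 1) :
    u ∈ auxBox β₁ σ ↔ ∀ i, ((σ i : ℕ) : ℝ) ≤ threshold n β₁ u i := by
  simp only [auxBox, Set.mem_univ_pi, Set.mem_Icc, (hu _).1.le, true_and]
  refine forall_congr' fun i => ?_
  have h1 : Real.log (u i) ≤ 0 := Real.log_nonpos (hu i).1.le (hu i).2
  rw [auxLength, ← Real.log_le_iff_le_exp (hu i).1, threshold, le_sub_comm,
    div_le_iff₀ (by positivity)]
  rcases le_total (((σ i : ℕ) : ℝ) - ((i : ℕ) : ℝ)) 0 with h | h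
  · rw [max_eq_right h]
    constructor
    · intro _; nlinarith
    · intro _; linarith
  · rw [max_eq_left h]
    constructor <;> intro _ <;> linarith

lemma exp_mul_setIntegral_auxBox (hβ : 0 < β₁) (σ : Perm (Fin n)) (g : (Fin n → ℝ) → ℝ) :
    Real.exp (β₂ * (numCycles σ : ℝ)) * ∫ u in auxBox β₁ σ, g u =
      ∫ u, restrictedWeight n (threshold n β₁ u) β₂ σ * g u
        ∂(Measure.pi fun _ : Fin n => unitLaw) := by
  rw [← pi_unitLaw_restrict_auxBox hβ, ← integral_indicator (measurableSet_auxBox σ),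
    ← integral_const_mul]
  refine integral_congr_ae ?_
  filter_upwards [pi_unitLaw_ae] with u hu
  by_cases h : u ∈ auxBox β₁ σ
  · rw [Set.indicator_of_mem h, restrictedWeight, if_pos ((mem_auxBox_iff hβ σ hu).1 h)]
  · rw [Set.indicator_of_notMem h, restrictedWeight,
      if_neg fun h' => h ((mem_auxBox_iff hβ σ hu).2 h')]
    simp

/-- Up to normalization, `restrictedWeight` is the joint density of state and auxiliary variables,
with the model as its marginal. Resampling the state given `u` preserves it: summing over `σ`
cancels the normalizer of `restrictedLaw`. -/
lemma sum_modelWeight_mul_transition (hβ : 0 < β₁) (σ' : Perm (Fin n)) :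
    ∑ σ, modelWeight n β₁ β₂ σ * transition n β₁ β₂ σ σ' = modelWeight n β₁ β₂ σ' := by
  have h1 : ∀ σ : Perm (Fin n), modelWeight n β₁ β₂ σ * transition n β₁ β₂ σ σ' =
      ∫ u, restrictedWeight n (threshold n β₁ u) β₂ σ *
        restrictedLaw n (threshold n β₁ u) β₂ σ' ∂(Measure.pi fun _ : Fin n => unitLaw) := by
    intro σ
    rw [modelWeight_eq, mul_assoc, transition_apply, exp_mul_setIntegral_auxBox hβ]
  have hvol : ∫ _u in auxBox β₁ σ', (1 : ℝ) = ∏ i, auxLength β₁ σ' i := by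
    rw [setIntegral_const, smul_eq_mul, mul_one, Measure.real, auxBox, volume_pi_pi,
      ENNReal.toReal_prod]
    refine Finset.prod_congr rfl fun i _ => ?_
    rw [Real.volume_Icc, sub_zero, ENNReal.toReal_ofReal (auxLength_pos _ _ _).le]
  have h2 : modelWeight n β₁ β₂ σ' = ∫ u, restrictedWeight n (threshold n β₁ u) β₂ σ' * 1
      ∂(Measure.pi fun _ : Fin n => unitLaw) := by
    rw [← exp_mul_setIntegral_auxBox hβ, hvol, modelWeight_eq]
  have hint : ∀ σ : Perm (Fin n), Integrable (fun u =>
      restrictedWeight n (threshold n β₁ u) β₂ σ * restrictedLaw n (threshold n β₁ u) β₂ σ')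
      (Measure.pi fun _ : Fin n => unitLaw) := by
    intro σ
    have hm1 : Measurable fun u => restrictedWeight n (threshold n β₁ u) β₂ σ :=
      (measurable_restrictedWeight β₂ σ).comp (measurable_threshold β₁)
    have hm2 : Measurable fun u => restrictedLaw n (threshold n β₁ u) β₂ σ' :=
      (measurable_restrictedLaw β₂ σ').comp (measurable_threshold β₁)
    refine Integrable.of_bound (hm1.mul hm2).aestronglyMeasurable
      (Real.exp (β₂ * (numCycles σ : ℝ)) * 1) (Filter.Eventually.of_forall fun u => ?_)
    rw [norm_mul, Real.norm_eq_abs, Real.norm_eq_abs, abs_of_nonneg (restrictedWeight_nonneg _ _ _),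
      abs_of_nonneg (restrictedLaw_nonneg _ _ _)]
    refine mul_le_mul ?_ (restrictedLaw_le_one _ _ _) (restrictedLaw_nonneg _ _ _) (by positivity)
    unfold restrictedWeight
    split_ifs
    · exact le_rfl
    · positivity
  simp only [h1]
  rw [h2, ← integral_finsetSum _ fun σ _ => hint σ]
  refine integral_congr_ae ?_
  filter_upwards [pi_unitLaw_ae] with u hu
  have hb : ∀ i : Fin n, ((i : ℕ) : ℝ) ≤ threshold n β₁ u i := by
    intro i
    have : Real.log (u i) / (2 * β₁) ≤ 0 :=
      div_nonpos_of_nonpos_of_nonneg (Real.log_nonpos (hu i).1.le (hu i).2) (by positivity)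
    rw [threshold]; linarith
  have hZ := sum_restrictedWeight_pos (β₂ := β₂) hb n
  rw [tailStab_self] at hZ
  simp only [restrictedLaw]
  rw [← Finset.sum_mul, mul_one, mul_div_cancel₀ _ hZ.ne']

lemma sum_modelWeight_pos : 0 < ∑ τ : Perm (Fin n), modelWeight n β₁ β₂ τ :=
  Finset.sum_pos (fun _ _ => Real.exp_pos _) univ_nonempty

lemma sum_model : ∑ σ : Perm (Fin n), model n β₁ β₂ σ = 1 := by
  unfold model
  rw [← Finset.sum_div, div_self sum_modelWeight_pos.ne']

lemma model_nonneg (σ : Perm (Fin n)) : 0 ≤ model n β₁ β₂ σ :=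
  div_nonneg (Real.exp_pos _).le sum_modelWeight_pos.le

lemma model_vecMul_transition (hβ : 0 < β₁) :
    Matrix.vecMul (model n β₁ β₂) (transition n β₁ β₂) = model n β₁ β₂ := by
  funext σ'
  simp only [Matrix.vecMul, dotProduct, model, div_mul_eq_mul_div]
  rw [← Finset.sum_div, sum_modelWeight_mul_transition hβ]

lemma model_vecMul_transition_pow (hβ : 0 < β₁) (l : ℕ) :
    Matrix.vecMul (model n β₁ β₂) (transition n β₁ β₂ ^ l) = model n β₁ β₂ := by
  induction l with
  | zero => simp
  | succ l ih => rw [pow_succ, ← Matrix.vecMul_vecMul, ih, model_vecMul_transition hβ]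

/-! ### From contraction to total variation. -/

lemma ExchangeLip.transition_pow_mulVec (hβ : 0 < β₁) (hc : β₁ ≤ 1 / 100 / (n : ℝ))
    (hβ₂ : 0 ≤ β₂) {f : Perm (Fin n) → ℝ} (hf : ExchangeLip 1 f) (l : ℕ) :
    ExchangeLip ((1 / 2) ^ l) ((transition n β₁ β₂ ^ l).mulVec f) := by
  induction l with
  | zero => simpa using hf
  | succ l ih =>
    have h := ih.transition_mulVec (by positivity) hβ hc hβ₂
    rw [Matrix.mulVec_mulVec, ← pow_succ'] at h
    rwa [pow_succ, mul_one_div]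

lemma exchangeLip_one_of_abs_sub_le {f : Perm (Fin n) → ℝ} (hf : ∀ σ τ, |f σ - f τ| ≤ 1) :
    ExchangeLip 1 f := by
  intro a b σ
  by_cases hab : a = b
  · subst hab; simp [swap_self, ← Perm.one_def]
  · refine (hf _ _).trans ?_
    rw [one_mul]
    have h : ((a : ℕ) : ℤ) - ((b : ℕ) : ℤ) ≠ 0 := by
      rw [sub_ne_zero]; exact_mod_cast fun h => hab (Fin.ext h)
    exact_mod_cast Int.one_le_abs h

lemma tvDist_transition_pow_le (hβ : 0 < β₁) (hc : β₁ ≤ 1 / 100 / (n : ℝ)) (hβ₂ : 0 ≤ β₂)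
    (l : ℕ) (σ : Perm (Fin n)) :
    tvDist ((transition n β₁ β₂ ^ l) σ) (model n β₁ β₂) ≤ (n : ℝ) ^ 2 * (1 / 2) ^ l := by
  set K := transition n β₁ β₂ ^ l
  set π := model n β₁ β₂
  -- This test function attains the total variation distance, and its oscillation of at most `1`
  -- makes it 1-Lipschitz.
  set f : Perm (Fin n) → ℝ := fun τ => if 0 ≤ K σ τ - π τ then 1 / 2 else -(1 / 2) with hf
  have hf1 : ∀ σ τ, |f σ - f τ| ≤ 1 := by
    intro σ τ
    simp only [hf]
    split_ifs <;> norm_num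
  have hlip := (exchangeLip_one_of_abs_sub_le hf1).transition_pow_mulVec hβ hc hβ₂ l
  have htv : tvDist (K σ) π = ∑ τ, (K σ τ - π τ) * f τ := by
    rw [tvDist, Finset.mul_sum]
    refine Finset.sum_congr rfl fun τ _ => ?_
    simp only [hf]
    split_ifs with h
    · rw [abs_of_nonneg h]; ring
    · rw [abs_of_neg (not_le.1 h)]; ring
  have hπ : ∑ τ, π τ * f τ = ∑ τ, π τ * K.mulVec f τ := by
    change dotProduct π f = dotProduct π (K.mulVec f)
    rw [Matrix.dotProduct_mulVec, model_vecMul_transition_pow hβ]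
  have hK : ∑ τ, K σ τ * f τ = ∑ τ, π τ * K.mulVec f σ := by
    rw [← Finset.sum_mul, sum_model, one_mul]; rfl
  rw [htv]
  simp only [sub_mul]
  rw [Finset.sum_sub_distrib, hπ, hK, ← Finset.sum_sub_distrib]
  calc ∑ τ, (π τ * K.mulVec f σ - π τ * K.mulVec f τ)
      ≤ ∑ τ, π τ * ((1 / 2) ^ l * (n : ℝ) ^ 2) := by
        refine Finset.sum_le_sum fun τ _ => ?_
        rw [← mul_sub]
        exact mul_le_mul_of_nonneg_left
          ((le_abs_self _).trans (hlip.abs_sub_le (by positivity) σ τ)) (model_nonneg τ)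
    _ = (n : ℝ) ^ 2 * (1 / 2) ^ l := by rw [← Finset.sum_mul, sum_model]; ring

lemma worstDist_transition_le (hβ : 0 < β₁) (hc : β₁ ≤ 1 / 100 / (n : ℝ)) (hβ₂ : 0 ≤ β₂) (l : ℕ) :
    worstDist (transition n β₁ β₂) (model n β₁ β₂) l ≤ (n : ℝ) ^ 2 * (1 / 2) ^ l :=
  ciSup_le fun σ => tvDist_transition_pow_le hβ hc hβ₂ l σ

lemma sq_mul_half_pow_le (hn : 0 < n) :
    (n : ℝ) ^ 2 * (1 / 2) ^ (3 + ⌈2 * Real.log (n : ℝ) / Real.log 2⌉₊) ≤ 1 / 4 := by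
  set m := ⌈2 * Real.log (n : ℝ) / Real.log 2⌉₊
  have hn' : (0 : ℝ) < n := by exact_mod_cast hn
  have hlog2 : 0 < Real.log 2 := Real.log_pos one_lt_two
  have h1 : 2 * Real.log (n : ℝ) ≤ m * Real.log 2 := by
    have := Nat.le_ceil (2 * Real.log (n : ℝ) / Real.log 2)
    rwa [div_le_iff₀ hlog2] at this
  have h2 : (n : ℝ) ^ 2 ≤ 2 ^ m := by
    rw [← Real.log_le_log_iff (by positivity) (by positivity), Real.log_pow, Real.log_pow]
    exact_mod_cast h1
  have h3 : (n : ℝ) ^ 2 * (1 / 2) ^ m ≤ 1 := by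
    rw [one_div, inv_pow, ← div_eq_mul_inv, div_le_one (by positivity)]
    exact h2
  rw [pow_add]
  linarith

end TwistedHitAndRun

theorem theorem4p1 :
    ∃ (c₁ c₂ : ℝ) (N : ℕ), 0 < c₁ ∧ 0 < c₂ ∧ 0 < N ∧
      ∀ (n : ℕ) (β₁ β₂ : ℝ), N ≤ n → 0 < β₁ → β₁ ≤ c₁ / (n : ℝ) → 0 ≤ β₂ → β₂ ≤ c₂ →
        (∀ l : ℕ,
          TwistedHitAndRun.worstDist (TwistedHitAndRun.transition n β₁ β₂)
              (TwistedHitAndRun.model n β₁ β₂) l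
            ≤ (n : ℝ) ^ 2 * (1 / 2 : ℝ) ^ ((l : ℤ) - 1)) ∧
        TwistedHitAndRun.mixingTime (TwistedHitAndRun.transition n β₁ β₂)
            (TwistedHitAndRun.model n β₁ β₂) (1 / 4)
          ≤ ((3 + ⌈2 * Real.log (n : ℝ) / Real.log 2⌉₊ : ℕ) : ℕ∞) := by
  -- The value `1 / 100` serves twice: it brings `48 * β₁ * n` below `1 / 2` and makes thresholds
  -- with `u i ≤ 15 / 16` exceed every label. The argument works for every `β₂ ≥ 0` and `n ≥ 1`, so
  -- the other two constants are arbitrary.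
  refine ⟨1 / 100, 1, 1, by norm_num, one_pos, one_pos, ?_⟩
  intro n β₁ β₂ hn hβ hc hβ₂ _
  refine ⟨fun l => ?_, ?_⟩
  · refine (TwistedHitAndRun.worstDist_transition_le hβ hc hβ₂ l).trans ?_
    refine mul_le_mul_of_nonneg_left ?_ (by positivity)
    rw [zpow_sub_one₀ (by norm_num), zpow_natCast]
    have : (0 : ℝ) < (1 / 2) ^ l := by positivity
    norm_num at this ⊢
  · exact sInf_le ⟨_, rfl, (TwistedHitAndRun.worstDist_transition_le hβ hc hβ₂ _).trans
      (TwistedHitAndRun.sq_mul_half_pow_le hn)⟩
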